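/- Conventions. Points of $\mathbb C^N$ are $z=(z_1,\dots,z_N)$, $dd^c=2i\partial\bar\partial$, and $\beta=dd^c|z|^2$ is the canonical Kähler form. For $1\le k\le N$ let $\Gamma_k$ be the set of real $(1,1)$-forms $\alpha$ with constant coefficients on $\mathbb C^N$ such that $\alpha^l\wedge\beta^{N-l}\ge 0$ for $l=1,\dots,k$. Let $\Omega\subseteq\mathbb C^N$ be open and connected. A subharmonic function $u:\Omega\to\mathbb R\cup\{-\infty\}$ (upper semicontinuous with the sub-mean value property; the constant $-\infty$ is allowed) is called \emph{$k$-subharmonic} if \[ dd^cu\wedge\alpha_1\wedge\dots\wedge\alpha_{k-1}\wedge\beta^{N-k}\ge 0 \] in the sense of currents for all $\alpha_1,\dots,\alpha_{k-1}\in\Gamma_k$, that is, $\int_\Omega u\,dd^c\chi\wedge\alpha_1\wedge\dots\wedge\alpha_{k-1}\wedge\beta^{N-k}\ge 0$ for every nonnegative $\chi\in C_c^\infty(\Omega)$; the function $u\equiv-\infty$ counts as $k$-subharmonic. Let $1\le m\le M$ and $1\le n\le N$, and let $\Omega_N\subseteq\mathbb C^N$ and $\Omega_M\subseteq\mathbb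 C^M$ be open and connected. A function $F:\Omega_N\to\Omega_M$ is called an \emph{$(m,n)$-subharmonic morphism} if for every $m$-subharmonic function $\varphi:\Omega_M\to\mathbb R\cup\{-\infty\}$ the function $\varphi\circ F:\Omega_N\to\mathbb R\cup\{-\infty\}$ is $n$-subharmonic. \textbf{Theorem.} Let $1\le m\le M$ and $1<n\le N$, let $\Omega_N\subseteq\mathbb C^N$ and $\Omega_M\subseteq\mathbb C^M$ be connected open sets, and let $F=(F^1,\dots,F^M):\Omega_N\to\Omega_M$ be an $(m,n)$-subharmonic morphism (not assumed to be continuous or holomorphic). Then $F$ is holomorphic or $\bar F=(\overline{F^1},\dots,\overline{F^M})$ is holomorphic. -/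

import Mathlib

open scoped ENNReal ContDiff

noncomputable section

namespace CNS

/-- Complex Euclidean space `ℂ^N`, with the Euclidean norm and Lebesgue measure. -/
abbrev Cn (N : ℕ) : Type := EuclideanSpace ℂ (Fin N)

/-! ### Constant coefficient forms on `ℂ^N` -/

/-- The complexified cotangent space of `ℂ^N`: complex valued `ℝ`-linear functionals. -/
abbrev Cotangent (N : ℕ) : Type := Cn N →ₗ[ℝ] ℂ

/-- The algebra of complex differential forms with constant coefficients on `ℂ^N`;
its product `*` is the wedge product. -/
abbrev CForm (N : ℕ) : Type := ExteriorAlgebra ℂ (Cotangent N)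

/-- The covector `dz_j`. -/
def dz {N : ℕ} (j : Fin N) : Cotangent N where
  toFun z := z j
  map_add' _ _ := PiLp.add_apply ..
  map_smul' _ _ := PiLp.smul_apply ..

/-- The covector `d\bar z_j`. -/
def dzbar {N : ℕ} (j : Fin N) : Cotangent N :=
  Complex.conjAe.toLinearMap ∘ₗ dz j

/-- The `(1,1)`-form `2i ∑ a_{jk} dz_j ∧ d\bar z_k` with coefficient matrix `a`.
It is real exactly when `a` is Hermitian. -/
def form11 {N : ℕ} (a : Matrix (Fin N) (Fin N) ℂ) : CForm N :=
  ∑ j, ∑ k, (2 * Complex.I * a j k) •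
    (ExteriorAlgebra.ι ℂ (dz j) * ExteriorAlgebra.ι ℂ (dzbar k))

/-- The positively oriented real basis `e_1, i e_1, e_2, i e_2, …, e_N, i e_N` of `ℂ^N`. -/
def realBasis (N : ℕ) (i : Fin (N * 2)) : Cn N :=
  EuclideanSpace.single (finProdFinEquiv.symm i).1
    (if (finProdFinEquiv.symm i).2 = 0 then 1 else Complex.I)

/-- Evaluation of a covector on the basis `realBasis N`. -/
def evalBasis (N : ℕ) : Cotangent N →ₗ[ℂ] (Fin (N * 2) → ℂ) where
  toFun φ i := φ (realBasis N i)
  map_add' _ _ := rfl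
  map_smul' _ _ := rfl

/-- The top degree coefficient of a form: the `ℂ`-linear functional that vanishes in degrees
other than `2N` and satisfies `ω = topCoeff ω • (dx_1 ∧ dy_1 ∧ … ∧ dx_N ∧ dy_N)` in degree `2N`,
i.e. `topCoeff ω` is the value of `ω` on the basis `e_1, i e_1, …, e_N, i e_N`. -/
def topCoeff (N : ℕ) : CForm N →ₗ[ℂ] ℂ :=
  ExteriorAlgebra.liftAlternating
    (Pi.single (N * 2) (Matrix.detRowAlternating.compLinearMap (evalBasis N)))

/-- The canonical Kähler form `β = dd^c |z|^2 = 2i ∑ dz_j ∧ d\bar z_j`. -/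
def kahler (N : ℕ) : CForm N := form11 1

/-- The cone `Γ_k` of real `(1,1)`-forms `α` with constant coefficients such that
`α^l ∧ β^(N-l) ≥ 0` for `l = 1, …, k`. (The top degree forms involved are real, so that
taking the real part of the coefficient loses nothing.) -/
def Gam (N k : ℕ) : Set (CForm N) :=
  {α | ∃ a : Matrix (Fin N) (Fin N) ℂ, a.IsHermitian ∧ α = form11 a ∧
    ∀ l : ℕ, 1 ≤ l → l ≤ k → 0 ≤ (topCoeff N (α ^ l * kahler N ^ (N - l))).re}

/-! ### The operator `dd^c` -/

/-- The Wirtinger derivative `∂f/∂z_j`. -/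
def wirt {N : ℕ} (j : Fin N) (f : Cn N → ℂ) (z : Cn N) : ℂ :=
  (fderiv ℝ f z (EuclideanSpace.single j 1)
    - Complex.I * fderiv ℝ f z (EuclideanSpace.single j Complex.I)) / 2

/-- The Wirtinger derivative `∂f/∂\bar z_j`. -/
def wirtBar {N : ℕ} (j : Fin N) (f : Cn N → ℂ) (z : Cn N) : ℂ :=
  (fderiv ℝ f z (EuclideanSpace.single j 1)
    + Complex.I * fderiv ℝ f z (EuclideanSpace.single j Complex.I)) / 2

/-- The form `dd^c χ = 2i ∂∂̄χ = 2i ∑ ∂²χ/∂z_j∂\bar z_k dz_j ∧ d\bar z_k` at the point `z`,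
for a smooth function `χ`. -/
def ddc {N : ℕ} (χ : Cn N → ℝ) (z : Cn N) : CForm N :=
  form11 (Matrix.of fun j k => wirt j (wirtBar k (fun w => (χ w : ℂ))) z)

/-! ### Subharmonic and `k`-subharmonic functions -/

/-- `u : Ω → ℝ ∪ {-∞}` is subharmonic on the open set `Ω`: it is upper semicontinuous and
satisfies the sub-mean value inequality on all closed balls contained in `Ω`. The function
`-∞` is admitted. The integral of `u` over a ball is the integral of the positive part (finite,
as `u` is bounded above on the ball) minus that of the negative part, with values in
`[-∞, ∞)`. Values of `u` outside `Ω` play no role. -/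
structure SubharmonicOn {N : ℕ} (Ω : Set (Cn N)) (u : Cn N → EReal) : Prop where
  ne_top : ∀ z ∈ Ω, u z ≠ ⊤
  usc : UpperSemicontinuousOn u Ω
  submean : ∀ (z : Cn N) (r : ℝ), 0 < r → Metric.closedBall z r ⊆ Ω →
    u z * ((MeasureTheory.volume (Metric.closedBall z r) : ℝ≥0∞) : EReal) ≤
      ((∫⁻ w in Metric.closedBall z r, (u w).toENNReal : ℝ≥0∞) : EReal)
        - ((∫⁻ w in Metric.closedBall z r, (-u w).toENNReal : ℝ≥0∞) : EReal)

/-- `u` is `k`-subharmonic on the open set `Ω ⊆ ℂ^N` (for `1 ≤ k ≤ N`): it is subharmonic and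
`dd^c u ∧ α_1 ∧ ⋯ ∧ α_{k-1} ∧ β^(N-k) ≥ 0` in the sense of currents for all
`α_1, …, α_{k-1} ∈ Γ_k`, i.e. `∫ u dd^c χ ∧ α_1 ∧ ⋯ ∧ α_{k-1} ∧ β^(N-k) ≥ 0` for all
nonnegative test functions `χ` on `Ω`. A subharmonic function that is not identically `-∞` on
a component of `Ω` is locally integrable there, so that it is finite almost everywhere;
where it is identically `-∞`, the inequality is void by `(⊥ : EReal).toReal = 0`. -/
structure KSubharmonicOn {N : ℕ} (k : ℕ) (Ω : Set (Cn N)) (u : Cn N → EReal) : Prop where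
  subharmonic : SubharmonicOn Ω u
  current_nonneg : ∀ α : Fin (k - 1) → CForm N, (∀ i, α i ∈ Gam N k) →
    ∀ χ : Cn N → ℝ, ContDiff ℝ ∞ χ → HasCompactSupport χ → tsupport χ ⊆ Ω → (∀ z, 0 ≤ χ z) →
      0 ≤ ∫ z in Ω, (u z).toReal *
        (topCoeff N (ddc χ z * (List.ofFn α).prod * kahler N ^ (N - k))).re

/-- `F : Ω → Ω'` is an `(m,n)`-subharmonic morphism, where `Ω ⊆ ℂ^N` and `Ω' ⊆ ℂ^M`: for every
`m`-subharmonic function `φ` on `Ω'`, the function `φ ∘ F` is `n`-subharmonic on `Ω`. -/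
structure IsSubharmonicMorphism {N M : ℕ} (m n : ℕ) (Ω : Set (Cn N)) (Ω' : Set (Cn M))
    (F : Cn N → Cn M) : Prop where
  mapsTo : Set.MapsTo F Ω Ω'
  comp : ∀ φ : Cn M → EReal, KSubharmonicOn m Ω' φ → KSubharmonicOn n Ω (fun z => φ (F z))

/-- The map `\bar F = (\bar F_1, …, \bar F_M)`. -/
def conjMap {N M : ℕ} (F : Cn N → Cn M) (z : Cn N) : Cn M :=
  WithLp.toLp 2 fun k => (starRingEnd ℂ) (F z k)

end CNS

end

noncomputable section

namespace CNS

/-! ### The top degree coefficients of products of `(1,1)`-forms -/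

/-! Pluriharmonic functions detect holomorphy. If `h` is the real or imaginary part of a coordinate
`z_j` or of a product `z_j z_k`, then `h` and `-h` are `m`-subharmonic for every `m`
(`kSubharmonicOn_of_levi_eq_zero`), so `h ∘ F` and `-(h ∘ F)` are both `n`-subharmonic.

For `n ≥ 2` such a two-sided condition forces `u = h ∘ F` to be smooth and pluriharmonic
(`contDiffAt_and_levi_eq_zero`). Subharmonicity of `±u` gives continuity and the mean value
property, and convolution with a radial bump then gives smoothness. Testing the current with one
factor `2i θ ∧ θ̄` and all others equal to `β` turns the inequalities into `‖w‖² tr L = L(w, w)` for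
every vector `w`, where `L` is the Levi form of `u`. Taking traces gives `tr L = N tr L`, hence `L =
0` because `N ≥ 2`. The algebra of top degree coefficients serves to compute this pairing.

Thus all `F^j` and `F^j F^k` are pluriharmonic, and the Leibniz rule leaves `∂F^j(w) ∂̄F^k(w') +
∂̄F^j(w') ∂F^k(w) = 0` (`del_mul_delbar_add`). If some `∂̄F^k` is nonzero at a point, the case `j =
k` gives `∂F^k = 0` nearby, and then `∂F^j = 0` nearby for every `j`. The coefficients of `∂F^j` are
holomorphic, so the identity theorem spreads this over the connected set `Ω`, and `F̄` is
holomorphic. If no such point exists, `F` is holomorphic. -/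

theorem add_pow_succ_of_sq_eq_zero {A : Type*} [Ring A] {x y : A} (hx : x * x = 0)
    (h : Commute x y) (p : ℕ) :
    (x + y) ^ (p + 1) = y ^ (p + 1) + (p + 1 : ℕ) • (x * y ^ p) := by
  induction p with
  | zero => simp [add_comm]
  | succ p ih =>
    have h1 : y * (x * y ^ p) = x * y ^ (p + 1) := by
      rw [← mul_assoc, ← h.eq, mul_assoc, pow_succ']
    have h2 : x * (x * y ^ p) = 0 := by rw [← mul_assoc, hx, zero_mul]
    rw [pow_succ', ih, add_mul, mul_add, mul_add, mul_smul_comm, mul_smul_comm, h1, h2,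
      ← pow_succ', succ_nsmul _ (p + 1)]
    simp only [smul_zero, add_zero]
    abel

/-- In every term of the expansion that contains `x`, that factor can be moved next to `z`, where it
vanishes. -/
theorem mul_add_pow_of_mul_eq_zero {A : Type*} [Ring A] {z x y : A} (hz : z * x = 0)
    (h : Commute x y) (p : ℕ) : z * (x + y) ^ p = z * y ^ p := by
  induction p with
  | zero => simp
  | succ p ih =>
    have hc : Commute x (y ^ p) := h.pow_right p
    rw [pow_succ, ← mul_assoc, ih, mul_add, mul_assoc, ← hc.eq, ← mul_assoc, hz, zero_mul,
      zero_add, mul_assoc, ← pow_succ]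

/-! ### Commutation rules for products of two covectors. -/

section Pairs

variable {V : Type*} [AddCommGroup V] [Module ℂ V]

theorem ι_mul_ι_anticomm (x y : V) :
    ExteriorAlgebra.ι ℂ x * ExteriorAlgebra.ι ℂ y =
      -(ExteriorAlgebra.ι ℂ y * ExteriorAlgebra.ι ℂ x) :=
  eq_neg_of_add_eq_zero_left (ExteriorAlgebra.ι_add_mul_swap x y)

theorem commute_pair_ι (x y z : V) :
    Commute (ExteriorAlgebra.ι ℂ x * ExteriorAlgebra.ι ℂ y) (ExteriorAlgebra.ι ℂ z) := by
  rw [Commute, SemiconjBy, mul_assoc, ι_mul_ι_anticomm y z, mul_neg, ← mul_assoc,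
    ι_mul_ι_anticomm x z, neg_mul, neg_neg, mul_assoc]

theorem commute_pair (x y z w : V) :
    Commute (ExteriorAlgebra.ι ℂ x * ExteriorAlgebra.ι ℂ y)
      (ExteriorAlgebra.ι ℂ z * ExteriorAlgebra.ι ℂ w) :=
  (commute_pair_ι x y z).mul_right (commute_pair_ι x y w)

theorem pair_mul_self (x y z : V) :
    ExteriorAlgebra.ι ℂ x * ExteriorAlgebra.ι ℂ y *
      (ExteriorAlgebra.ι ℂ x * ExteriorAlgebra.ι ℂ z) = 0 := by
  rw [← mul_assoc, (commute_pair_ι x y x).eq, ← mul_assoc, ExteriorAlgebra.ι_sq_zero]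
  simp

theorem pair_mul_self_right (x y z : V) :
    ExteriorAlgebra.ι ℂ x * ExteriorAlgebra.ι ℂ y *
      (ExteriorAlgebra.ι ℂ z * ExteriorAlgebra.ι ℂ y) = 0 := by
  rw [← mul_assoc, (commute_pair_ι x y z).eq, mul_assoc, mul_assoc, ExteriorAlgebra.ι_sq_zero]
  simp

theorem pair_mul_pair_swap (x y z w : V) :
    ExteriorAlgebra.ι ℂ x * ExteriorAlgebra.ι ℂ w *
      (ExteriorAlgebra.ι ℂ z * ExteriorAlgebra.ι ℂ y) =
    -(ExteriorAlgebra.ι ℂ x * ExteriorAlgebra.ι ℂ y *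
      (ExteriorAlgebra.ι ℂ z * ExteriorAlgebra.ι ℂ w)) := by
  rw [mul_assoc, ← mul_assoc _ (ExteriorAlgebra.ι ℂ z), (commute_pair_ι w z y).eq,
    ι_mul_ι_anticomm w z]
  simp [mul_assoc]

end Pairs

/-! ### Products of the elementary (1,1)-forms with powers of the Kähler form. -/

/-- The `(1,1)`-form `2i dz_j ∧ d\bar z_k`. -/
def elem {N : ℕ} (j k : Fin N) : CForm N :=
  (2 * Complex.I) • (ExteriorAlgebra.ι ℂ (dz j) * ExteriorAlgebra.ι ℂ (dzbar k))

theorem form11_eq {N : ℕ} (a : Matrix (Fin N) (Fin N) ℂ) :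
    form11 a = ∑ j, ∑ k, a j k • elem j k := by
  simp only [form11, elem, smul_smul, mul_comm (a _ _)]

theorem kahler_eq (N : ℕ) : kahler N = ∑ j, elem j j := by
  rw [kahler, form11_eq]
  refine Finset.sum_congr rfl fun j _ => ?_
  rw [Finset.sum_eq_single j] <;> simp +contextual [eq_comm]

theorem commute_elem {N : ℕ} (j k p q : Fin N) : Commute (elem j k) (elem p q) :=
  ((commute_pair _ _ _ _).smul_left _).smul_right _

theorem elem_mul_elem_left {N : ℕ} (j k q : Fin N) : elem j k * elem j q = 0 := by
  simp [elem, pair_mul_self]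

theorem elem_mul_elem_right {N : ℕ} (j k p : Fin N) : elem j k * elem p k = 0 := by
  simp [elem, pair_mul_self_right]

theorem elem_mul_elem_swap {N : ℕ} (j p : Fin N) :
    elem j p * elem p j = -(elem j j * elem p p) := by
  simp only [elem, smul_mul_smul_comm, pair_mul_pair_swap (dz j) (dzbar j), smul_neg]

/-- The Kähler form in the variables `z_l`, `l ∈ S`. -/
def partialKahler {N : ℕ} (S : Finset (Fin N)) : CForm N := ∑ l ∈ S, elem l l

theorem commute_partialKahler {N : ℕ} (j k : Fin N) (S : Finset (Fin N)) :
    Commute (elem j k) (partialKahler S) :=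
  Commute.sum_right _ _ _ fun l _ => commute_elem j k l l

theorem partialKahler_insert {N : ℕ} {l : Fin N} {S : Finset (Fin N)} (h : l ∉ S) :
    partialKahler (insert l S) = elem l l + partialKahler S := by
  simp [partialKahler, Finset.sum_insert h]

theorem partialKahler_univ (N : ℕ) : partialKahler (Finset.univ : Finset (Fin N)) = kahler N :=
  (kahler_eq N).symm

/-- A sum of `|S|` commuting elements of square zero: any longer product repeats one of them. -/
theorem partialKahler_pow_eq_zero {N : ℕ} (S : Finset (Fin N)) :
    ∀ p, S.card < p → partialKahler S ^ p = 0 := by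
  induction S using Finset.induction_on with
  | empty => intro p hp; simp [partialKahler, (Nat.pos_of_ne_zero (by simpa using hp.ne')).ne']
  | insert l S hl ih =>
    intro p hp
    rw [Finset.card_insert_of_notMem hl] at hp
    obtain ⟨q, rfl⟩ : ∃ q, p = q + 1 := ⟨p - 1, by omega⟩
    rw [partialKahler_insert hl, add_pow_succ_of_sq_eq_zero (elem_mul_elem_left l l l)
      (commute_partialKahler _ _ _), ih _ (by omega), ih _ (by omega)]
    simp

theorem partialKahler_insert_pow {N : ℕ} {l : Fin N} {S : Finset (Fin N)} (h : l ∉ S) {p : ℕ}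
    (hp : S.card ≤ p) :
    partialKahler (insert l S) ^ (p + 1) = (p + 1 : ℕ) • (elem l l * partialKahler S ^ p) := by
  rw [partialKahler_insert h, add_pow_succ_of_sq_eq_zero (elem_mul_elem_left l l l)
    (commute_partialKahler _ _ _), partialKahler_pow_eq_zero _ _ (by omega), zero_add]

/-- A form that already uses the variables in `S` sees only the part of `β` in the remaining
variables, so the vanishing results below come down to counting `Sᶜ`. -/
theorem mul_kahler_pow {N : ℕ} {x : CForm N} (S : Finset (Fin N))
    (hx : ∀ l ∈ S, x * elem l l = 0) (p : ℕ) :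
    x * kahler N ^ p = x * partialKahler Sᶜ ^ p := by
  have h : kahler N = partialKahler S + partialKahler Sᶜ := by
    rw [kahler_eq, partialKahler, partialKahler, Finset.sum_add_sum_compl]
  rw [h, mul_add_pow_of_mul_eq_zero]
  · rw [partialKahler, Finset.mul_sum]
    exact Finset.sum_eq_zero hx
  · exact Commute.sum_left _ _ _ fun l _ => commute_partialKahler _ _ _

theorem elem_self_mul_kahler_pow {N : ℕ} (j : Fin N) :
    (N : ℂ) • (elem j j * kahler N ^ (N - 1)) = kahler N ^ N := by
  obtain ⟨n, rfl⟩ : ∃ n, N = n + 1 := ⟨N - 1, by have := j.pos; omega⟩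
  rw [mul_kahler_pow {j} (by simp [elem_mul_elem_left])]
  have h : kahler (n + 1) = partialKahler (insert j {j}ᶜ) := by
    rw [← partialKahler_univ]; congr 1; ext; simp
  rw [h, partialKahler_insert_pow (by simp) (by simp [Finset.card_compl]),
    ← Nat.cast_smul_eq_nsmul ℂ]
  simp

theorem elem_mul_kahler_pow_of_ne {N : ℕ} {j k : Fin N} (h : j ≠ k) :
    elem j k * kahler N ^ (N - 1) = 0 := by
  have hx : ∀ l ∈ ({j, k} : Finset (Fin N)), elem j k * elem l l = 0 := by
    simp [elem_mul_elem_left, elem_mul_elem_right]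
  have hc := Finset.card_pair h
  have := Finset.card_le_univ ({j, k} : Finset (Fin N))
  rw [mul_kahler_pow _ hx, partialKahler_pow_eq_zero, mul_zero]
  rw [Finset.card_compl, hc, Fintype.card_fin] at *
  omega

theorem elem_mul_elem_mul_kahler_pow {N : ℕ} {j p : Fin N} (h : j ≠ p) :
    ((N : ℂ) * (N - 1 : ℕ)) • (elem j j * elem p p * kahler N ^ (N - 2)) = kahler N ^ N := by
  have hc := Finset.card_pair h
  have hle := Finset.card_le_univ ({j, p} : Finset (Fin N))
  rw [hc, Fintype.card_fin] at hle
  obtain ⟨n, rfl⟩ : ∃ n, N = n + 2 := ⟨N - 2, by omega⟩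
  have hx : ∀ l ∈ ({j, p} : Finset (Fin (n + 2))), elem j j * elem p p * elem l l = 0 := by
    have : elem j j * elem p p * elem j j = 0 := by
      rw [(commute_elem j j p p).eq, mul_assoc, elem_mul_elem_left, mul_zero]
    simp [mul_assoc, elem_mul_elem_left] at this ⊢
    exact this
  rw [mul_kahler_pow _ hx]
  have h' : kahler (n + 2) = partialKahler (insert j (insert p {j, p}ᶜ)) := by
    rw [← partialKahler_univ]; congr 1; ext i
    by_cases h1 : i = j <;> by_cases h2 : i = p <;> simp [h1, h2]
  have hp : p ∉ ({j, p}ᶜ : Finset (Fin (n + 2))) := by simp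
  have hcc : ({j, p}ᶜ : Finset (Fin (n + 2))).card = n := by
    rw [Finset.card_compl, hc]; simp
  rw [h', partialKahler_insert_pow (by simp [h]) (by rw [Finset.card_insert_of_notMem hp, hcc]),
    partialKahler_insert_pow hp hcc.le]
  have hn : ((n + 2 : ℕ) : ℂ) * ((n + 2 - 1 : ℕ) : ℂ) = ((n + 1 + 1 : ℕ) : ℂ) * (n + 1 : ℕ) := rfl
  rw [hn]
  simp only [mul_smul_comm, ← Nat.cast_smul_eq_nsmul ℂ, smul_smul, mul_assoc, Nat.add_sub_cancel]

/-- With three or more indices in use, at most `N - 3` variables remain to fill the power `N - 2`.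
-/
theorem elem_mul_elem_mul_kahler_pow_eq_zero {N : ℕ} {j k p q : Fin N}
    (h : 2 < ({j, p, k, q} : Finset (Fin N)).card) :
    elem j k * elem p q * kahler N ^ (N - 2) = 0 := by
  have hx : ∀ l ∈ ({j, p, k, q} : Finset (Fin N)), elem j k * elem p q * elem l l = 0 := by
    intro l hl
    simp only [Finset.mem_insert, Finset.mem_singleton] at hl
    have hc := (commute_elem j k p q).eq
    rcases hl with rfl | rfl | rfl | rfl
    · rw [hc, mul_assoc, elem_mul_elem_left, mul_zero]
    · rw [mul_assoc, elem_mul_elem_left, mul_zero]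
    · rw [hc, mul_assoc, elem_mul_elem_right, mul_zero]
    · rw [mul_assoc, elem_mul_elem_right, mul_zero]
  have := Finset.card_le_univ ({j, p, k, q} : Finset (Fin N))
  rw [mul_kahler_pow _ hx, partialKahler_pow_eq_zero, mul_zero]
  rw [Finset.card_compl, Fintype.card_fin] at *
  omega

theorem topCoeff_elem_mul_kahler {N : ℕ} (j k : Fin N) :
    topCoeff N (elem j k * kahler N ^ (N - 1)) =
      topCoeff N (kahler N ^ N) / N * (if j = k then 1 else 0) := by
  split_ifs with h
  · subst h
    have hN : (N : ℂ) ≠ 0 := Nat.cast_ne_zero.2 j.pos.ne'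
    rw [← elem_self_mul_kahler_pow j, map_smul, smul_eq_mul]
    field_simp
  · simp [elem_mul_kahler_pow_of_ne h]

theorem topCoeff_elem_mul_elem_mul_kahler {N : ℕ} (j k p q : Fin N) :
    topCoeff N (elem j k * elem p q * kahler N ^ (N - 2)) =
      topCoeff N (kahler N ^ N) / (N * (N - 1 : ℕ)) *
        ((if j = k then 1 else 0) * (if p = q then 1 else 0)
          - (if j = q then 1 else 0) * (if p = k then 1 else 0)) := by
  by_cases hjp : j = p
  · subst hjp
    rw [elem_mul_elem_left]
    split_ifs <;> simp
  by_cases hkq : k = q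
  · subst hkq
    rw [elem_mul_elem_right]
    split_ifs <;> simp
  have key : topCoeff N (elem j j * elem p p * kahler N ^ (N - 2)) =
      topCoeff N (kahler N ^ N) / (N * (N - 1 : ℕ)) := by
    have hle := Finset.card_le_univ ({j, p} : Finset (Fin N))
    rw [Finset.card_pair hjp, Fintype.card_fin] at hle
    have hN : (N : ℂ) ≠ 0 := Nat.cast_ne_zero.2 (by omega)
    have hN' : ((N - 1 : ℕ) : ℂ) ≠ 0 := Nat.cast_ne_zero.2 (by omega)
    rw [← elem_mul_elem_mul_kahler_pow hjp, map_smul, smul_eq_mul]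
    field_simp
  by_cases h1 : j = k ∧ p = q
  · obtain ⟨rfl, rfl⟩ := h1
    simp [key, hjp]
  by_cases h2 : j = q ∧ p = k
  · obtain ⟨rfl, rfl⟩ := h2
    simp [elem_mul_elem_swap, key, hjp]
  have hr : ((if j = k then 1 else 0) * (if p = q then 1 else 0)
          - (if j = q then 1 else 0) * (if p = k then 1 else 0) : ℂ) = 0 := by
    split_ifs <;> simp_all
  rw [elem_mul_elem_mul_kahler_pow_eq_zero, hr]
  · simp
  -- If `k` and `q`, which are distinct, both lay in `{j, p}`, they would match it in one of the two
  -- ways already excluded.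
  have h3 : (k ≠ j ∧ k ≠ p) ∨ (q ≠ j ∧ q ≠ p) := by grind
  rcases h3 with h3 | h3
  · refine lt_of_lt_of_le (b := ({j, p, k} : Finset (Fin N)).card) ?_ (Finset.card_le_card ?_)
    · rw [Finset.card_eq_three.2 ⟨j, p, k, hjp, h3.1.symm, h3.2.symm, rfl⟩]; omega
    · intro i; simp; tauto
  · refine lt_of_lt_of_le (b := ({j, p, q} : Finset (Fin N)).card) ?_ (Finset.card_le_card ?_)
    · rw [Finset.card_eq_three.2 ⟨j, p, q, hjp, h3.1.symm, h3.2.symm, rfl⟩]; omega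
    · intro i; simp; tauto

theorem topCoeff_form11_mul_kahler {N : ℕ} (a : Matrix (Fin N) (Fin N) ℂ) :
    topCoeff N (form11 a * kahler N ^ (N - 1)) = topCoeff N (kahler N ^ N) / N * a.trace := by
  simp only [form11_eq, Finset.sum_mul, smul_mul_assoc, map_sum, map_smul,
    topCoeff_elem_mul_kahler, Matrix.trace, Matrix.diag, Finset.mul_sum]
  refine Finset.sum_congr rfl fun j _ => ?_
  simp
  ring

/-- Only two matchings of the indices contribute: the direct one gives `tr a · tr b`, and the
crossed one gives `tr (ab)` with the sign from `elem_mul_elem_swap`. -/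
theorem topCoeff_form11_mul_form11_mul_kahler {N : ℕ} (a b : Matrix (Fin N) (Fin N) ℂ) :
    topCoeff N (form11 a * form11 b * kahler N ^ (N - 2)) =
      topCoeff N (kahler N ^ N) / (N * (N - 1 : ℕ)) * (a.trace * b.trace - (a * b).trace) := by
  have h : form11 a * form11 b =
      ∑ j, ∑ p, ∑ k, ∑ q, (a j k * b p q) • (elem j k * elem p q) := by
    simp only [form11_eq, Finset.sum_mul_sum, smul_mul_smul_comm]
  have h2 : (a * b).trace = ∑ j, ∑ p, a j p * b p j := by
    simp [Matrix.trace, Matrix.mul_apply]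
  have h1 : a.trace * b.trace = ∑ j, ∑ p, a j j * b p p := by
    simp [Matrix.trace, Finset.sum_mul_sum]
  simp only [h, Finset.sum_mul, smul_mul_assoc, map_sum, map_smul,
    topCoeff_elem_mul_elem_mul_kahler, h1, h2, ← Finset.sum_sub_distrib, Finset.mul_sum]
  refine Finset.sum_congr rfl fun j _ => Finset.sum_congr rfl fun p _ => ?_
  simp only [mul_sub, Finset.sum_sub_distrib, mul_ite, mul_one, mul_zero, smul_eq_mul]
  simp
  ring

/-! ### The volume form -/

theorem kahler_pow_eq (N : ℕ) :
    kahler N ^ N = (N.factorial : ℂ) • ((List.finRange N).map fun j => elem j j).prod := by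
  have h : ∀ l : List (Fin N), l.Nodup → partialKahler l.toFinset ^ l.length =
      (l.length.factorial : ℂ) • (l.map fun j => elem j j).prod := by
    intro l
    induction l with
    | nil => simp
    | cons j l ih =>
      intro hl
      rw [List.nodup_cons] at hl
      rw [List.toFinset_cons, List.length_cons,
        partialKahler_insert_pow (by simpa using hl.1) l.toFinset_card_le, ih hl.2,
        List.map_cons, List.prod_cons, ← Nat.cast_smul_eq_nsmul ℂ, mul_smul_comm, smul_smul,
        Nat.factorial_succ, Nat.cast_mul]
  simpa [partialKahler_univ] using h _ (List.nodup_finRange N)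

/-- The covectors `dz_1, d\bar z_1, …, dz_N, d\bar z_N`. -/
def covectors (N : ℕ) (i : Fin (N * 2)) : Cotangent N :=
  if (finProdFinEquiv.symm i).2 = 0 then dz (finProdFinEquiv.symm i).1
  else dzbar (finProdFinEquiv.symm i).1

theorem covectors_finProdFinEquiv {N : ℕ} (j : Fin N) (b : Fin 2) :
    covectors N (finProdFinEquiv (j, b)) = if b = 0 then dz j else dzbar j := by
  simp only [covectors, Equiv.symm_apply_apply]

theorem realBasis_finProdFinEquiv {N : ℕ} (j : Fin N) (b : Fin 2) :
    realBasis N (finProdFinEquiv (j, b)) =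
      EuclideanSpace.single j (if b = 0 then 1 else Complex.I) := by
  simp only [realBasis, Equiv.symm_apply_apply]

theorem prod_elem_eq (N : ℕ) : ((List.finRange N).map fun j => elem j j).prod =
    (2 * Complex.I) ^ N • ExteriorAlgebra.ιMulti ℂ (N * 2) (covectors N) := by
  have h : ∀ l : List (Fin N), (l.map fun j => elem j j).prod = (2 * Complex.I) ^ l.length •
      (l.map fun j => ExteriorAlgebra.ι ℂ (dz j) * ExteriorAlgebra.ι ℂ (dzbar j)).prod := by
    intro l
    induction l with
    | nil => simp
    | cons j l ih =>
      rw [List.map_cons, List.prod_cons, ih, elem, smul_mul_smul_comm, List.length_cons, pow_succ',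
        List.map_cons, List.prod_cons]
  rw [h, List.length_finRange, ExteriorAlgebra.ιMulti_apply, List.ofFn_mul, List.prod_flatten,
    List.map_ofFn, ← List.ofFn_eq_map]
  congr 3
  ext1 j
  have h0 (b : Fin 2) (hb : (j : ℕ) * 2 + b < N * 2) :
      (⟨(j : ℕ) * 2 + b, hb⟩ : Fin (N * 2)) = finProdFinEquiv (j, b) := by
    ext; simp [finProdFinEquiv]; ring
  simp only [Function.comp_apply, h0, covectors_finProdFinEquiv]
  simp

/-- On the real basis the covectors form a block diagonal matrix with blocks `(1, i; 1, -i)`, each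
of determinant `-2i`. -/
theorem topCoeff_ιMulti_covectors (N : ℕ) :
    topCoeff N (ExteriorAlgebra.ιMulti ℂ (N * 2) (covectors N)) = (-2 * Complex.I) ^ N := by
  rw [topCoeff, ExteriorAlgebra.liftAlternating_apply_ιMulti, Pi.single_eq_same,
    AlternatingMap.compLinearMap_apply]
  have h : Matrix.submatrix (Matrix.of fun i l => covectors N i (realBasis N l))
      ((Equiv.prodComm _ _).trans finProdFinEquiv) ((Equiv.prodComm _ _).trans finProdFinEquiv) =
      Matrix.blockDiagonal fun _ : Fin N => !![1, Complex.I; 1, -Complex.I] := by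
    ext ⟨b, j⟩ ⟨c, k⟩
    simp only [Matrix.submatrix_apply, Equiv.trans_apply, Equiv.prodComm_apply, Prod.swap_prod_mk,
      Matrix.of_apply, covectors_finProdFinEquiv, realBasis_finProdFinEquiv]
    fin_cases b <;> fin_cases c <;> by_cases hjk : j = k <;>
      simp [dz, dzbar, hjk, Matrix.blockDiagonal_apply]
  have h2 := congrArg Matrix.det h
  rw [Matrix.det_blockDiagonal, Matrix.det_submatrix_equiv_self] at h2
  refine h2.trans ?_
  rw [Finset.prod_const, Matrix.det_fin_two_of, Finset.card_fin]
  congr 1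
  ring

/-- The later arguments depend on this constant only through its being real and positive. -/
theorem topCoeff_kahler_pow (N : ℕ) :
    topCoeff N (kahler N ^ N) = ((N.factorial * 4 ^ N : ℝ) : ℂ) := by
  rw [kahler_pow_eq, prod_elem_eq, map_smul, map_smul, topCoeff_ιMulti_covectors, smul_eq_mul,
    smul_eq_mul, ← mul_pow]
  have : 2 * Complex.I * (-2 * Complex.I) = 4 := by
    linear_combination -4 * Complex.I_mul_I
  rw [this]
  push_cast
  ring

/-! ### Second derivatives and the Levi form -/

/-- The second derivative of `f` at `z`. -/
def hess {E G : Type*} [NormedAddCommGroup E] [NormedSpace ℝ E] [NormedAddCommGroup G]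
    [NormedSpace ℝ G] (f : E → G) (z : E) : E →L[ℝ] E →L[ℝ] G :=
  fderiv ℝ (fderiv ℝ f) z

/-- Four times the symmetric part of the Levi form of `f` at `z`. -/
def levi {E G : Type*} [NormedAddCommGroup E] [NormedSpace ℂ E] [NormedAddCommGroup G]
    [NormedSpace ℝ G] (f : E → G) (z w w' : E) : G :=
  hess f z w w' + hess f z (Complex.I • w) (Complex.I • w')

section Hess

variable {E G : Type*} [NormedAddCommGroup E] [NormedSpace ℝ E] [NormedAddCommGroup G]
  [NormedSpace ℝ G]

theorem fderiv_fderiv_apply {f : E → G} {z : E} (hf : ContDiffAt ℝ 2 f z) (w w' : E) :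
    fderiv ℝ (fun y => fderiv ℝ f y w') z w = hess f z w w' := by
  have h : DifferentiableAt ℝ (fderiv ℝ f) z :=
    (hf.fderiv_right (m := 1) (by norm_num)).differentiableAt (by norm_num)
  rw [fderiv_clm_apply h (differentiableAt_const _)]
  simp [hess]

theorem hess_symm {f : E → G} {z : E} (hf : ContDiffAt ℝ 2 f z) (w w' : E) :
    hess f z w w' = hess f z w' w :=
  hf.isSymmSndFDerivAt (by simp) w w'

theorem hess_congr {f g : E → G} {z : E} (h : f =ᶠ[nhds z] g) : hess f z = hess g z :=
  h.fderiv.fderiv_eq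

theorem hess_eq_zero_of_notMem_tsupport {f : E → G} {z : E} (h : z ∉ tsupport f) :
    hess f z = 0 := by
  rw [hess_congr (notMem_tsupport_iff_eventuallyEq.1 h)]
  simp [hess, Pi.zero_def]

theorem contDiffAt_two {f : E → G} (hf : ContDiff ℝ ∞ f) (z : E) : ContDiffAt ℝ 2 f z := by
  exact_mod_cast (contDiff_infty.1 hf 2).contDiffAt

theorem continuous_hess {f : E → G} (hf : ContDiff ℝ ∞ f) (w w' : E) :
    Continuous fun z => hess f z w w' := by
  have h1 : ContDiff ℝ ∞ (fderiv ℝ f) := hf.fderiv_right (by simp)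
  have h2 : ContDiff ℝ ∞ (hess f) := h1.fderiv_right (by simp)
  exact (h2.continuous.clm_apply continuous_const).clm_apply continuous_const

end Hess

section Levi

variable {E G : Type*} [NormedAddCommGroup E] [NormedSpace ℂ E] [NormedAddCommGroup G]
  [NormedSpace ℝ G]

theorem levi_add_right (f : E → G) (z w w₁ w₂ : E) :
    levi f z w (w₁ + w₂) = levi f z w w₁ + levi f z w w₂ := by
  simp only [levi, smul_add, map_add]; abel

theorem levi_add_left (f : E → G) (z w w₁ w₂ : E) :
    levi f z (w₁ + w₂) w = levi f z w₁ w + levi f z w₂ w := by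
  simp only [levi, smul_add, map_add, add_apply]; abel

theorem levi_symm {f : E → G} {z : E} (hf : ContDiffAt ℝ 2 f z) (w w' : E) :
    levi f z w w' = levi f z w' w := by
  rw [levi, hess_symm hf, hess_symm hf (Complex.I • w), levi]

theorem levi_congr {f g : E → G} {z : E} (h : f =ᶠ[nhds z] g) (w w' : E) :
    levi f z w w' = levi g z w w' := by
  rw [levi, levi, hess_congr h]

theorem levi_I_smul (f : E → G) (z w w' : E) :
    levi f z (Complex.I • w) (Complex.I • w') = levi f z w w' := by
  simp [levi, smul_smul, add_comm]

theorem levi_I_smul_right (f : E → G) (z w w' : E) :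
    levi f z w (Complex.I • w') = hess f z w (Complex.I • w') - hess f z (Complex.I • w) w' := by
  simp [levi, smul_smul, sub_eq_add_neg]

theorem levi_I_smul_self {f : E → G} {z : E} (hf : ContDiffAt ℝ 2 f z) (w : E) :
    levi f z w (Complex.I • w) = 0 := by
  rw [levi_I_smul_right, hess_symm hf, sub_self]

theorem levi_eq_zero_of_diag {f : E → G} {z : E} (hf : ContDiffAt ℝ 2 f z)
    (h : ∀ w, levi f z w w = 0) (w w' : E) : levi f z w w' = 0 := by
  have h1 := h (w + w')
  rw [levi_add_right, levi_add_left, levi_add_left, h, h, levi_symm hf w', zero_add, add_zero,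
    ← two_smul ℝ, smul_eq_zero] at h1
  exact h1.resolve_left two_ne_zero

theorem continuous_levi {f : E → G} (hf : ContDiff ℝ ∞ f) (w w' : E) :
    Continuous fun z => levi f z w w' :=
  (continuous_hess hf w w').add (continuous_hess hf _ _)

theorem levi_eq_zero_of_notMem_tsupport {f : E → G} {z : E} (h : z ∉ tsupport f) (w w' : E) :
    levi f z w w' = 0 := by
  simp [levi, hess_eq_zero_of_notMem_tsupport h]

end Levi

/-! ### The complex Hessian in terms of the real Levi form. -/

theorem single_I {N : ℕ} (j : Fin N) :
    (EuclideanSpace.single j Complex.I : Cn N) =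
      Complex.I • (EuclideanSpace.single j 1 : Cn N) := by
  ext i; simp

theorem wirt_wirtBar {N : ℕ} {χ : Cn N → ℝ} (hχ : ContDiff ℝ ∞ χ) (z : Cn N) (j k : Fin N) :
    wirt j (wirtBar k fun w => (χ w : ℂ)) z =
      ((levi χ z (EuclideanSpace.single j 1) (EuclideanSpace.single k 1) : ℝ)
        + Complex.I * (levi χ z (EuclideanSpace.single j 1)
          (Complex.I • EuclideanSpace.single k 1) : ℝ)) / 4 := by
  have h1 (y v : Cn N) : fderiv ℝ (fun w => (χ w : ℂ)) y v = (fderiv ℝ χ y v : ℂ) := by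
    have := (Complex.ofRealCLM.hasFDerivAt (x := χ y)).comp y
      ((hχ.differentiable (by simp)).differentiableAt (x := y)).hasFDerivAt
    have h := this.fderiv
    simp only [Function.comp_def, Complex.ofRealCLM_apply] at h
    rw [h]; simp
  have hd (v : Cn N) : DifferentiableAt ℝ (fun y => fderiv ℝ χ y v) z := by
    have : ContDiff ℝ ∞ (fderiv ℝ χ) := hχ.fderiv_right (by simp)
    exact ((this.clm_apply contDiff_const).differentiable (by simp)).differentiableAt
  have hd' (v : Cn N) : HasFDerivAt (fun y => (fderiv ℝ χ y v : ℂ))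
      (Complex.ofRealCLM ∘L (fderiv ℝ (fun y => fderiv ℝ χ y v) z)) z :=
    (Complex.ofRealCLM.hasFDerivAt (x := fderiv ℝ χ z v)).comp z (hd v).hasFDerivAt
  have h2 (v : Cn N) : fderiv ℝ (wirtBar k fun w => (χ w : ℂ)) z v =
      (hess χ z v (EuclideanSpace.single k 1) +
        Complex.I * hess χ z v (EuclideanSpace.single k Complex.I)) / 2 := by
    have h3 : wirtBar k (fun w => (χ w : ℂ)) = fun y =>
      (2 : ℂ)⁻¹ * ((fderiv ℝ χ y (EuclideanSpace.single k 1) : ℂ) +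
        Complex.I * (fderiv ℝ χ y (EuclideanSpace.single k Complex.I) : ℂ)) := by
      ext y; rw [wirtBar, h1, h1]; ring
    have h4 := ((hd' (EuclideanSpace.single k 1)).add
      ((hd' (EuclideanSpace.single k Complex.I)).const_mul Complex.I)).const_mul (2 : ℂ)⁻¹
    rw [h3]
    erw [h4.fderiv]
    simp [fderiv_fderiv_apply (contDiffAt_two hχ z)]
    ring
  rw [wirt, h2, h2, levi_I_smul_right, levi]
  simp only [single_I]
  push_cast
  linear_combination
    -(hess χ z (Complex.I • EuclideanSpace.single j 1) (Complex.I • EuclideanSpace.single k 1) : ℂ)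
      / 4 * Complex.I_mul_I

/-- The pairing of `dd^c χ` with a form is a combination of values of the Levi form of `χ`. -/
theorem topCoeff_ddc_mul_re {N : ℕ} {χ : Cn N → ℝ} (hχ : ContDiff ℝ ∞ χ) (z : Cn N)
    (x : CForm N) :
    (topCoeff N (ddc χ z * x)).re = ∑ j, ∑ k,
      (levi χ z (EuclideanSpace.single j 1) (EuclideanSpace.single k 1) *
          ((topCoeff N (elem j k * x)).re / 4)
        - levi χ z (EuclideanSpace.single j 1) (Complex.I • EuclideanSpace.single k 1) *
          ((topCoeff N (elem j k * x)).im / 4)) := by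
  simp only [ddc, form11_eq, Finset.sum_mul, smul_mul_assoc, map_sum, map_smul, Matrix.of_apply,
    wirt_wirtBar hχ, Complex.re_sum, smul_eq_mul]
  refine Finset.sum_congr rfl fun j _ => Finset.sum_congr rfl fun k _ => ?_
  rw [div_mul_eq_mul_div, Complex.div_ofNat_re]
  simp
  ring

/-! ### Rank-one forms and their pairing with `dd^c`. -/

/-- The matrix of the `(1,1)`-form `2i θ ∧ \bar θ`, `θ = ∑ \bar w_j dz_j`. -/
def rankOne {N : ℕ} (w : Cn N) : Matrix (Fin N) (Fin N) ℂ :=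
  Matrix.of fun j k => starRingEnd ℂ (w j) * w k

theorem trace_rankOne {N : ℕ} (w : Cn N) : (rankOne w).trace = ((‖w‖ ^ 2 : ℝ) : ℂ) := by
  rw [EuclideanSpace.norm_sq_eq]
  simp [Matrix.trace, rankOne, Complex.conj_mul']

theorem form11_rankOne_sq {N : ℕ} (w : Cn N) :
    form11 (rankOne w) * form11 (rankOne w) = 0 := by
  have h : form11 (rankOne w) = (2 * Complex.I) •
      (ExteriorAlgebra.ι ℂ (∑ j, starRingEnd ℂ (w j) • dz j) *
        ExteriorAlgebra.ι ℂ (∑ k, w k • dzbar k)) := by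
    simp only [form11_eq, map_sum, map_smul, Finset.sum_mul_sum, Finset.smul_sum,
      smul_mul_smul_comm, elem, rankOne, Matrix.of_apply]
    refine Finset.sum_congr rfl fun j _ => Finset.sum_congr rfl fun k _ => smul_comm _ _ _
  rw [h, smul_mul_smul_comm, pair_mul_self, smul_zero]

/-- The form has square zero, so only `l = 1` has content, and there the coefficient is a positive
multiple of the trace `‖w‖²`. -/
theorem form11_rankOne_mem_Gam {N : ℕ} (k : ℕ) (w : Cn N) : form11 (rankOne w) ∈ Gam N k := by
  refine ⟨rankOne w, ?_, rfl, fun l hl _ => ?_⟩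
  · ext i j
    simp [rankOne, mul_comm]
  · obtain rfl | ⟨p, rfl⟩ : l = 1 ∨ ∃ p, l = p + 2 := by
      obtain h | h := hl.eq_or_lt
      · exact .inl h.symm
      · exact .inr ⟨l - 2, by omega⟩
    · rw [pow_one, topCoeff_form11_mul_kahler, trace_rankOne, topCoeff_kahler_pow,
        ← Complex.ofReal_natCast, ← Complex.ofReal_div, ← Complex.ofReal_mul, Complex.ofReal_re]
      positivity
    · rw [pow_add, pow_two, form11_rankOne_sq]
      simp

theorem kahler_mem_Gam (N k : ℕ) (hk : k ≤ N) : kahler N ∈ Gam N k := by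
  refine ⟨1, Matrix.isHermitian_one, rfl, fun l _ hl => ?_⟩
  rw [← pow_add, Nat.add_sub_cancel' (hl.trans hk), topCoeff_kahler_pow, Complex.ofReal_re]
  positivity

theorem levi_smul_right {N : ℕ} (f : Cn N → ℝ) (z w w' : Cn N) (r : ℝ) :
    levi f z w (r • w') = r * levi f z w w' := by
  simp only [levi, smul_comm Complex.I r, map_smul, smul_eq_mul, mul_add]

theorem levi_smul_left {N : ℕ} (f : Cn N → ℝ) (z w w' : Cn N) (r : ℝ) :
    levi f z (r • w) w' = r * levi f z w w' := by
  simp only [levi, smul_comm Complex.I r, map_smul, smul_apply, smul_eq_mul, mul_add]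

theorem levi_I_smul_left {N : ℕ} (f : Cn N → ℝ) (z w w' : Cn N) :
    levi f z (Complex.I • w) w' = -levi f z w (Complex.I • w') := by
  simp [levi, smul_smul]

/-- Four times the Levi form of `f` at `z`, as a sesquilinear form. -/
def leviForm {N : ℕ} (f : Cn N → ℝ) (z : Cn N) :
    Cn N →ₗ[ℂ] Cn N →ₛₗ[starRingEnd ℂ] ℂ :=
  LinearMap.mk₂'ₛₗ (RingHom.id ℂ) (starRingEnd ℂ)
    (fun w w' => ((levi f z w w' : ℝ) : ℂ) + Complex.I * ((levi f z w (Complex.I • w') : ℝ) : ℂ))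
    (fun w₁ w₂ w => by simp only [levi_add_left]; push_cast; ring)
    (fun c w w' => by
      have hc : c • w = c.re • w + c.im • Complex.I • w := by
        conv_lhs => rw [← Complex.re_add_im c]
        rw [add_smul, mul_smul, Complex.coe_smul, Complex.coe_smul]
      rw [hc, levi_add_left, levi_add_left, levi_smul_left, levi_smul_left, levi_smul_left,
        levi_smul_left, levi_I_smul_left, levi_I_smul, RingHom.id_apply, smul_eq_mul]
      conv_rhs => rw [← Complex.re_add_im c]
      push_cast
      linear_combination
        -(c.im : ℂ) * ((levi f z w (Complex.I • w') : ℝ) : ℂ) * Complex.I_mul_I)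
    (fun w w₁ w₂ => by simp only [smul_add, levi_add_right]; push_cast; ring)
    (fun c w w' => by
      have hc : c • w' = c.re • w' + c.im • Complex.I • w' := by
        conv_lhs => rw [← Complex.re_add_im c]
        rw [add_smul, mul_smul, Complex.coe_smul, Complex.coe_smul]
      have hI : levi f z w (Complex.I • Complex.I • w') = -levi f z w w' := by
        simp [levi, smul_smul, add_comm]
      rw [hc, smul_add, smul_comm Complex.I c.re, smul_comm Complex.I c.im, levi_add_right,
        levi_add_right, levi_smul_right, levi_smul_right, levi_smul_right, levi_smul_right, hI,
        smul_eq_mul]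
      conv_rhs => rw [← Complex.re_add_im c]
      simp only [map_add, map_mul, Complex.conj_ofReal, Complex.conj_I]
      push_cast
      linear_combination
        (c.im : ℂ) * ((levi f z w (Complex.I • w') : ℝ) : ℂ) * Complex.I_mul_I)

theorem levi_eq_sum {N : ℕ} {χ : Cn N → ℝ} (hχ : ContDiff ℝ ∞ χ) (z w : Cn N) :
    ((levi χ z w w / 4 : ℝ) : ℂ) = ∑ j, ∑ k,
      wirt j (wirtBar k fun w => (χ w : ℂ)) z * (w j * starRingEnd ℂ (w k)) := by
  have h1 : leviForm χ z w w = ((levi χ z w w : ℝ) : ℂ) := by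
    simp [leviForm, levi_I_smul_self (contDiffAt_two hχ z)]
  have h2 : w = ∑ j, w j • (EuclideanSpace.single j 1 : Cn N) := by
    ext i; simp [Finset.sum_apply, Pi.single_apply]
  rw [Complex.ofReal_div, ← h1]
  conv_lhs => rw [h2]
  simp only [map_sum, map_smul, LinearMap.sum_apply, LinearMap.smul_apply, LinearMap.map_smulₛₗ,
    smul_eq_mul, wirt_wirtBar hχ, Finset.sum_div, Finset.mul_sum]
  refine (Finset.sum_comm).trans
    (Finset.sum_congr rfl fun j _ => Finset.sum_congr rfl fun k _ => ?_)
  simp [leviForm]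
  ring

/-- The trace formula for the complex Hessian `a` and `b = rankOne w`: here `tr b = ‖w‖²`, and `tr
(ab)` is the value of the Hessian on `w`. -/
theorem topCoeff_ddc_mul_rankOne {N : ℕ} {χ : Cn N → ℝ} (hχ : ContDiff ℝ ∞ χ) (z w : Cn N) :
    (topCoeff N (ddc χ z * form11 (rankOne w) * kahler N ^ (N - 2))).re =
      N.factorial * 4 ^ N / (N * (N - 1 : ℕ)) / 4 *
        (‖w‖ ^ 2 * ∑ j, levi χ z (EuclideanSpace.single j 1) (EuclideanSpace.single j 1)
          - levi χ z w w) := by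
  have h1 : (Matrix.of (fun j k => wirt j (wirtBar k fun w => (χ w : ℂ)) z) * rankOne w).trace =
      ((levi χ z w w / 4 : ℝ) : ℂ) := by
    rw [levi_eq_sum hχ]
    simp only [Matrix.trace, Matrix.diag, Matrix.mul_apply, rankOne, Matrix.of_apply]
    exact Finset.sum_congr rfl fun j _ => Finset.sum_congr rfl fun k _ => by ring
  have h2 : (Matrix.of (fun j k => wirt j (wirtBar k fun w => (χ w : ℂ)) z)).trace =
      ((∑ j, levi χ z (EuclideanSpace.single j 1) (EuclideanSpace.single j 1) / 4 : ℝ) : ℂ) := by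
    simp only [Matrix.trace, Matrix.diag, Matrix.of_apply, wirt_wirtBar hχ,
      levi_I_smul_self (contDiffAt_two hχ z)]
    push_cast
    simp
  rw [ddc, topCoeff_form11_mul_form11_mul_kahler, h1, h2, trace_rankOne, topCoeff_kahler_pow,
    ← Finset.sum_div]
  have h3 (a b c d e f : ℝ) : ((a : ℂ) / (b * c) * (d * e - f)).re = a / (b * c) * (d * e - f) := by
    rw [← Complex.ofReal_re (a / (b * c) * (d * e - f))]; push_cast; rfl
  have h4 := h3 (N.factorial * 4 ^ N) N (N - 1 : ℕ)
  rw [Complex.ofReal_natCast, Complex.ofReal_natCast] at h4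
  rw [h4]
  ring

open MeasureTheory

/-! ### Integration by parts and mean values -/

/-- Two integrations by parts without boundary terms; symmetry of the Hessian restores the order of
the directions. -/
theorem integral_mul_hess {N : ℕ} {g χ : Cn N → ℝ} (hg : ContDiff ℝ ∞ g) (hχ : ContDiff ℝ ∞ χ)
    (hc : HasCompactSupport χ) (w w' : Cn N) :
    ∫ z, g z * hess χ z w w' = ∫ z, hess g z w w' * χ z := by
  have hg1 (v : Cn N) : ContDiff ℝ ∞ fun z => fderiv ℝ g z v :=
    (hg.fderiv_right (m := ∞) (by simp)).clm_apply contDiff_const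
  have hχ1 (v : Cn N) : ContDiff ℝ ∞ fun z => fderiv ℝ χ z v :=
    (hχ.fderiv_right (m := ∞) (by simp)).clm_apply contDiff_const
  have hc1 (v : Cn N) : HasCompactSupport fun z => fderiv ℝ χ z v := hc.fderiv_apply ℝ v
  have hint {a b : Cn N → ℝ} (ha : Continuous a) (hb : Continuous b) (hbc : HasCompactSupport b) :
      Integrable (fun z => a z * b z) :=
    (ha.mul hb).integrable_of_hasCompactSupport hbc.mul_left
  have hd {a : Cn N → ℝ} (ha : ContDiff ℝ ∞ a) (v : Cn N) :
      Continuous fun z => fderiv ℝ a z v :=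
    ((ha.fderiv_right (m := ∞) (by simp)).clm_apply contDiff_const).continuous
  have e1 := integral_mul_fderiv_eq_neg_fderiv_mul_of_integrable (μ := (volume : Measure (Cn N)))
    (f := g) (g := fun z => fderiv ℝ χ z w') (v := w)
    (hint (hd hg w) (hχ1 w').continuous (hc1 w'))
    (hint hg.continuous (hd (hχ1 w') w) ((hc1 w').fderiv_apply ℝ w))
    (hint hg.continuous (hχ1 w').continuous (hc1 w'))
    (fun z _ => (hg.differentiable (by simp)).differentiableAt)
    (fun z _ => ((hχ1 w').differentiable (by simp)).differentiableAt)
  have e2 := integral_mul_fderiv_eq_neg_fderiv_mul_of_integrable (μ := (volume : Measure (Cn N)))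
    (f := fun z => fderiv ℝ g z w) (g := χ) (v := w')
    (hint (hd (hg1 w) w') hχ.continuous hc)
    (hint (hg1 w).continuous (hd hχ w') (hc1 w'))
    (hint (hg1 w).continuous hχ.continuous hc)
    (fun z _ => ((hg1 w).differentiable (by simp)).differentiableAt)
    (fun z _ => (hχ.differentiable (by simp)).differentiableAt)
  rw [e2, neg_neg] at e1
  simp only [fderiv_fderiv_apply (contDiffAt_two hχ _), fderiv_fderiv_apply (contDiffAt_two hg _),
    hess_symm (contDiffAt_two hg _) w'] at e1
  exact e1

theorem integrable_mul_levi {N : ℕ} {g χ : Cn N → ℝ} (hg : Continuous g) (hχ : ContDiff ℝ ∞ χ)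
    (hc : HasCompactSupport χ) (w w' : Cn N) :
    Integrable fun z => g z * levi χ z w w' := by
  refine (hg.mul (continuous_levi hχ w w')).integrable_of_hasCompactSupport
    (HasCompactSupport.mul_left ?_)
  exact HasCompactSupport.intro hc fun z hz => levi_eq_zero_of_notMem_tsupport hz w w'

theorem integral_mul_levi {N : ℕ} {g χ : Cn N → ℝ} (hg : ContDiff ℝ ∞ g) (hχ : ContDiff ℝ ∞ χ)
    (hc : HasCompactSupport χ) (w w' : Cn N) :
    ∫ z, g z * levi χ z w w' = ∫ z, levi g z w w' * χ z := by
  have h1 (v v' : Cn N) : Integrable fun z => g z * hess χ z v v' :=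
    (hg.continuous.mul (continuous_hess hχ v v')).integrable_of_hasCompactSupport
      (HasCompactSupport.mul_left (HasCompactSupport.intro hc fun z hz => by
        simp [hess_eq_zero_of_notMem_tsupport hz]))
  have h2 (v v' : Cn N) : Integrable fun z => hess g z v v' * χ z :=
    ((continuous_hess hg v v').mul hχ.continuous).integrable_of_hasCompactSupport hc.mul_left
  simp only [levi, mul_add, add_mul]
  rw [integral_add (h1 _ _) (h1 _ _), integral_add (h2 _ _) (h2 _ _), integral_mul_hess hg hχ hc,
    integral_mul_hess hg hχ hc]

/-! ### Mean values over balls and the pluriharmonic test functions. -/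

theorem ereal_lintegral_sub_lintegral {α : Type*} [MeasurableSpace α] {μ : Measure α} {u : α → ℝ}
    (hu : Integrable u μ) :
    ((∫⁻ x, (u x : EReal).toENNReal ∂μ : ℝ≥0∞) : EReal)
      - ((∫⁻ x, (-(u x : EReal)).toENNReal ∂μ : ℝ≥0∞) : EReal) = ((∫ x, u x ∂μ : ℝ) : EReal) := by
  simp only [← EReal.coe_neg, EReal.real_coe_toENNReal]
  rw [integral_eq_lintegral_pos_part_sub_lintegral_neg_part hu, EReal.coe_sub,
    EReal.coe_ennreal_toReal hu.lintegral_lt_top.ne,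
    EReal.coe_ennreal_toReal (Integrable.lintegral_lt_top (f := fun x => -u x) hu.neg).ne]

/-- Multiplication by `i` on `ℂ^N`. -/
def mulI (N : ℕ) : Cn N ≃ₗᵢ[ℝ] Cn N where
  toLinearEquiv := (LinearEquiv.smulOfNeZero ℂ (Cn N) Complex.I Complex.I_ne_zero).restrictScalars ℝ
  norm_map' z := by simp [norm_smul]

/-- The ball is invariant under multiplication by `i`, so the integral may be averaged over the
orbit `w, iw, -w, -iw`, where the hypothesis is a pointwise mean value identity. This suffices for
polynomials of degree at most two. -/
theorem setIntegral_closedBall_eq {N : ℕ} {u : Cn N → ℝ} (hu : Continuous u) (z : Cn N) (r : ℝ)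
    (h : ∀ w, u (z + w) + u (z + Complex.I • w) + u (z - w) + u (z - Complex.I • w) = 4 * u z) :
    ∫ w in Metric.closedBall z r, u w = volume.real (Metric.closedBall z r) * u z := by
  have e0 : ∫ w in Metric.closedBall z r, u w = ∫ w in Metric.closedBall 0 r, u (z + w) := by
    rw [← (measurePreserving_add_left volume z).setIntegral_preimage_emb
      (measurableEmbedding_addLeft z)]
    simp [preimage_add_closedBall]
  have hball : mulI N ⁻¹' Metric.closedBall 0 r = Metric.closedBall 0 r := by
    simp
  have e1 (v : Cn N → ℝ) : ∫ w in Metric.closedBall (0 : Cn N) r, v (Complex.I • w) =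
      ∫ w in Metric.closedBall (0 : Cn N) r, v w := by
    have := (mulI N).measurePreserving.setIntegral_preimage_emb
      (mulI N).toHomeomorph.measurableEmbedding v (Metric.closedBall 0 r)
    rw [hball] at this
    exact this
  have hi {v : Cn N → ℝ} (hv : Continuous v) : IntegrableOn v (Metric.closedBall 0 r) :=
    hv.continuousOn.integrableOn_compact (isCompact_closedBall _ _)
  have e2 := e1 fun w => u (z + w)
  have e3 := e1 fun w => u (z + Complex.I • w)
  have e4 := e1 fun w => u (z + Complex.I • Complex.I • w)
  simp only [smul_smul, Complex.I_mul_I, neg_smul, one_smul, smul_neg, ← sub_eq_add_neg]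
    at e2 e3 e4
  have e5 : ∫ w in Metric.closedBall (0 : Cn N) r,
      (u (z + w) + u (z + Complex.I • w) + u (z - w) + u (z - Complex.I • w)) =
      4 * (volume.real (Metric.closedBall z r) * u z) := by
    simp only [h]
    rw [setIntegral_const, smul_eq_mul, measureReal_def, measureReal_def,
      Measure.addHaar_closedBall_center volume z r]
    ring
  rw [integral_add, integral_add, integral_add] at e5
  · rw [e0]; linarith
  all_goals exact hi (by fun_prop)

theorem integrableOn_closedBall {N : ℕ} {u : Cn N → ℝ} {z : Cn N} {r : ℝ}
    (hu : ContinuousOn u (Metric.closedBall z r)) : IntegrableOn u (Metric.closedBall z r) :=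
  hu.integrableOn_compact (isCompact_closedBall _ _)

/-- The sub-mean value inequality of a real valued function in terms of its Bochner integral. -/
theorem submean_iff {N : ℕ} {u : Cn N → ℝ} {z : Cn N} {r : ℝ}
    (hu : ContinuousOn u (Metric.closedBall z r)) :
    (u z : EReal) * ((volume (Metric.closedBall z r) : ℝ≥0∞) : EReal) ≤
      ((∫⁻ w in Metric.closedBall z r, (u w : EReal).toENNReal : ℝ≥0∞) : EReal)
        - ((∫⁻ w in Metric.closedBall z r, (-(u w : EReal)).toENNReal : ℝ≥0∞) : EReal) ↔
    volume.real (Metric.closedBall z r) * u z ≤ ∫ w in Metric.closedBall z r, u w := by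
  rw [ereal_lintegral_sub_lintegral (integrableOn_closedBall hu),
    ← EReal.coe_ennreal_toReal measure_closedBall_lt_top.ne, ← EReal.coe_mul, EReal.coe_le_coe_iff,
    mul_comm, measureReal_def]

/-- Smooth functions with vanishing Levi form and the four point mean value property are
`k`-subharmonic for all `k`. -/
theorem kSubharmonicOn_of_levi_eq_zero {N : ℕ} (k : ℕ) (Ω : Set (Cn N)) {u : Cn N → ℝ}
    (hu : ContDiff ℝ ∞ u) (hl : ∀ z w w', levi u z w w' = 0)
    (h : ∀ z w,
      u (z + w) + u (z + Complex.I • w) + u (z - w) + u (z - Complex.I • w) = 4 * u z) :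
    KSubharmonicOn k Ω fun z => (u z : EReal) where
  subharmonic :=
    { ne_top := fun z _ => EReal.coe_ne_top _
      usc := (continuous_coe_real_ereal.comp hu.continuous).upperSemicontinuous.upperSemicontinuousOn Ω
      submean := fun z r _ _ => by
        rw [submean_iff hu.continuous.continuousOn,
          setIntegral_closedBall_eq hu.continuous z r (h z)] }
  current_nonneg α _ χ hχ hc hs _ := by
    simp only [EReal.toReal_coe, mul_assoc, topCoeff_ddc_mul_re hχ]
    rw [setIntegral_eq_integral_of_forall_compl_eq_zero]
    · have hi (w w' : Cn N) (c : ℝ) : Integrable fun z => u z * (levi χ z w w' * c) := by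
        simpa only [mul_assoc] using (integrable_mul_levi hu.continuous hχ hc w w').mul_const c
      -- Integration by parts moves the Levi form onto `u`, where it vanishes: the current `dd^c u`
      -- is zero.
      have h0 (w w' : Cn N) (c : ℝ) : ∫ z, u z * (levi χ z w w' * c) = 0 := by
        simp only [← mul_assoc]
        rw [integral_mul_const, integral_mul_levi hu hχ hc]
        simp [hl]
      have hi2 (w w₁ w₂ : Cn N) (c d : ℝ) : Integrable fun z =>
          u z * (levi χ z w w₁ * c) - u z * (levi χ z w w₂ * d) := (hi _ _ _).sub (hi _ _ _)
      simp only [Finset.mul_sum, mul_sub]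
      rw [integral_finsetSum _ fun j _ => integrable_finsetSum _ fun k _ => hi2 _ _ _ _ _]
      refine (Finset.sum_eq_zero fun j _ => ?_).ge
      rw [integral_finsetSum _ fun k _ => hi2 _ _ _ _ _]
      refine Finset.sum_eq_zero fun k _ => ?_
      rw [integral_sub (hi _ _ _) (hi _ _ _), h0, h0, sub_zero]
    · intro z hz
      simp [levi_eq_zero_of_notMem_tsupport fun h => hz (hs h)]

/-! ### Functions with the mean value property are smooth -/

/-- A function with the mean value property for balls has it for radial weights. -/
theorem integral_mul_radial {N : ℕ} {u : Cn N → ℝ} {z : Cn N} {R : ℝ}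
    (hu : ContinuousOn u (Metric.closedBall z R))
    (hm : ∀ r, 0 < r → r ≤ R → ∫ w in Metric.closedBall z r, u w =
      volume.real (Metric.closedBall z r) * u z)
    {g : ℝ → ℝ} (hg : Continuous g) :
    ∫ w in Metric.closedBall z R, u w * g (dist w z) =
      u z * ∫ w in Metric.closedBall z R, g (dist w z) := by
  set v : Cn N → ℝ := fun w => u w - u z with hv
  set ρ : Measure (Cn N) := volume.restrict (Metric.closedBall z R) with hρ
  have hvc : ContinuousOn v (Metric.closedBall z R) := hu.sub continuousOn_const
  have hvi : Integrable v ρ := integrableOn_closedBall hvc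
  have hvn : Integrable (fun w => -v w) ρ := hvi.neg
  have hci : Integrable (fun _ => u z) ρ := integrableOn_closedBall continuousOn_const
  have hd : Measurable fun w : Cn N => dist w z := (continuous_id.dist continuous_const).measurable
  -- Subtracting the central value gives mean zero on every concentric ball, including the
  -- degenerate radii.
  have hball (a : ℝ) : ∫ w in Metric.closedBall z a, v w ∂ρ = 0 := by
    have hinter : Metric.closedBall z a ∩ Metric.closedBall z R = Metric.closedBall z (min a R) := by
      ext; simp
    rw [hρ, Measure.restrict_restrict Metric.isClosed_closedBall.measurableSet, hinter]
    obtain hb | hb | hb := lt_trichotomy (min a R) 0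
    · simp [Metric.closedBall_eq_empty.2 hb]
    · simp [hb, hv]
    · have hsub : Metric.closedBall z (min a R) ⊆ Metric.closedBall z R :=
        Metric.closedBall_subset_closedBall (min_le_right _ _)
      rw [hv, integral_sub (integrableOn_closedBall (hu.mono hsub))
        (integrableOn_closedBall continuousOn_const), hm _ hb (min_le_right _ _),
        setIntegral_const, smul_eq_mul, sub_self]
  -- The positive and negative parts of `v` are pushed forward to the line by the distance to `z`.
  -- The zero means say that the two finite measures agree on every half-line `Iic a`, so they
  -- coincide, and integrating `g` against both gives the claim.
  let μ (s : Cn N → ℝ) : Measure ℝ :=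
    (ρ.withDensity fun w => ENNReal.ofReal (s w)).map fun w => dist w z
  have hμ : μ v = μ (fun w => -v w) := by
    have : IsFiniteMeasure (ρ.withDensity fun w => ENNReal.ofReal (v w)) :=
      isFiniteMeasure_withDensity_ofReal hvi.2
    refine Measure.ext_of_Iic _ _ fun a => ?_
    have hpre : (fun w : Cn N => dist w z) ⁻¹' Set.Iic a = Metric.closedBall z a := rfl
    rw [Measure.map_apply hd measurableSet_Iic, Measure.map_apply hd measurableSet_Iic, hpre,
      withDensity_apply _ Metric.isClosed_closedBall.measurableSet,
      withDensity_apply _ Metric.isClosed_closedBall.measurableSet]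
    have hi : Integrable v (ρ.restrict (Metric.closedBall z a)) := hvi.restrict
    have h := hball a
    rw [integral_eq_lintegral_pos_part_sub_lintegral_neg_part hi, sub_eq_zero] at h
    exact (ENNReal.toReal_eq_toReal_iff' hi.lintegral_lt_top.ne
      (Integrable.lintegral_lt_top (f := fun x => -v x) hi.neg).ne).1 h
  have hint (s : Cn N → ℝ) (hs : Integrable s ρ) :
      ∫ t, g t ∂(μ s) = ∫ w, max (s w) 0 * g (dist w z) ∂ρ := by
    rw [integral_map hd.aemeasurable hg.aestronglyMeasurable,
      integral_withDensity_eq_integral_toReal_smul₀ hs.1.aemeasurable.ennreal_ofReal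
        (by simp)]
    simp [ENNReal.toReal_ofReal']
  have hgi {s : Cn N → ℝ} (hs : Integrable s ρ) : Integrable (fun w => s w * g (dist w z)) ρ := by
    obtain ⟨C, hC⟩ := (isCompact_Icc (a := (0 : ℝ)) (b := R)).exists_bound_of_continuousOn
      hg.continuousOn
    refine hs.mul_bdd (c := C) (hg.measurable.comp hd).aestronglyMeasurable ?_
    filter_upwards [ae_restrict_mem Metric.isClosed_closedBall.measurableSet] with w hw
    exact hC _ ⟨dist_nonneg, hw⟩
  have h1 := hint v hvi
  rw [hμ, hint _ hvn] at h1
  have h2 : ∫ w, v w * g (dist w z) ∂ρ = 0 := by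
    have h3 (w : Cn N) : v w * g (dist w z) =
        max (v w) 0 * g (dist w z) - max (-v w) 0 * g (dist w z) := by
      rw [← sub_mul, max_zero_sub_max_neg_zero_eq_self]
    simp only [h3]
    rw [integral_sub (hgi hvi.pos_part) (hgi hvn.pos_part)]
    exact sub_eq_zero.2 h1.symm
  have hui : Integrable u ρ := integrableOn_closedBall hu
  simp only [hv, sub_mul] at h2
  rw [integral_sub (hgi hui) (hgi hci), integral_const_mul] at h2
  exact sub_eq_zero.1 h2

/-- By the mean value property, convolution with a normalised radial bump reproduces `u`, while the
convolution is smooth. The radius `2 * R` leaves room for a ball of radius `R` around each point of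
the smaller ball. -/
theorem exists_contDiff_eqOn_ball {N : ℕ} {u : Cn N → ℝ} {x₀ : Cn N} {R : ℝ} (hR : 0 < R)
    (hu : ContinuousOn u (Metric.closedBall x₀ (2 * R)))
    (hm : ∀ z r, 0 < r → Metric.closedBall z r ⊆ Metric.closedBall x₀ (2 * R) →
      ∫ w in Metric.closedBall z r, u w = volume.real (Metric.closedBall z r) * u z) :
    ∃ g : Cn N → ℝ, ContDiff ℝ ∞ g ∧ Set.EqOn u g (Metric.ball x₀ R) := by
  -- The profile depends on `t ^ 2`, which keeps the radial bump smooth at the origin.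
  let γ : ℝ → ℝ := fun t => Real.smoothTransition (1 - t ^ 2 / R ^ 2)
  have hγ : Continuous γ := Real.smoothTransition.continuous.comp (by fun_prop)
  have hγ0 {t : ℝ} (ht : R ≤ t) : γ t = 0 := by
    refine Real.smoothTransition.zero_of_nonpos (sub_nonpos.2 ?_)
    rw [one_le_div (by positivity)]
    gcongr
  let ρ : Cn N → ℝ := fun y => γ ‖y‖
  have hρ : ContDiff ℝ ∞ ρ := by
    refine Real.smoothTransition.contDiff.comp ?_
    exact contDiff_const.sub ((contDiff_norm_sq ℝ).div_const _)
  have hρ0 {y : Cn N} (hy : y ∉ Metric.closedBall 0 R) : ρ y = 0 := by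
    refine hγ0 ?_
    simpa using (not_le.1 (by simpa using hy)).le
  have hρc : HasCompactSupport ρ :=
    HasCompactSupport.intro (isCompact_closedBall 0 R) fun y hy => hρ0 hy
  set c := ∫ y, ρ y with hc
  have hcpos : 0 < c := by
    refine hρ.continuous.integral_pos_of_hasCompactSupport_nonneg_nonzero hρc
      (fun y => Real.smoothTransition.nonneg _) (x := 0) ?_
    simp [ρ, γ]
  let ũ := (Metric.closedBall x₀ (2 * R)).indicator u
  have hũ : LocallyIntegrable ũ :=
    ((integrableOn_closedBall hu).integrable_indicator
      Metric.isClosed_closedBall.measurableSet).locallyIntegrable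
  refine ⟨fun x => c⁻¹ * convolution ũ ρ (ContinuousLinearMap.mul ℝ ℝ) volume x,
    contDiff_const.mul (hρc.contDiff_convolution_right _ hũ hρ), fun x hx => ?_⟩
  have hsub : Metric.closedBall x R ⊆ Metric.closedBall x₀ (2 * R) :=
    Metric.closedBall_subset_closedBall' (by rw [two_mul]; gcongr; exact (Metric.mem_ball.1 hx).le)
  have h1 := integral_mul_radial (hu.mono hsub)
    (fun r hr hrR => hm x r hr ((Metric.closedBall_subset_closedBall hrR).trans hsub)) hγ
  have h2 : ∫ w in Metric.closedBall x R, γ (dist w x) = c := by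
    rw [setIntegral_eq_integral_of_forall_compl_eq_zero]
    · simp only [dist_eq_norm]
      exact integral_sub_right_eq_self ρ x
    · exact fun w hw => hγ0 (not_le.1 hw).le
  have h3 : convolution ũ ρ (ContinuousLinearMap.mul ℝ ℝ) volume x =
      ∫ w in Metric.closedBall x R, u w * γ (dist w x) := by
    rw [convolution, ← setIntegral_eq_integral_of_forall_compl_eq_zero (s := Metric.closedBall x R)]
    · refine setIntegral_congr_fun Metric.isClosed_closedBall.measurableSet fun w hw => ?_
      simp [ũ, ρ, Set.indicator_of_mem (hsub hw), dist_eq_norm_sub']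
    · intro w hw
      have : ρ (x - w) = 0 := hγ0 (by rw [← dist_eq_norm']; exact (not_le.1 hw).le)
      simp [this]
  change u x = c⁻¹ * _
  rw [h3, h1, h2]
  field_simp

/-! ### Functions `u` such that `u` and `-u` are `n`-subharmonic -/

/-- Test with a bump supported where `P` keeps the sign of `P y`. -/
theorem eq_zero_of_integral_mul_eq_zero {N : ℕ} {P : Cn N → ℝ} (hP : Continuous P)
    {U : Set (Cn N)} (hU : IsOpen U)
    (h : ∀ χ : Cn N → ℝ, ContDiff ℝ ∞ χ → HasCompactSupport χ → tsupport χ ⊆ U →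
      (∀ z, 0 ≤ χ z) → ∫ z, P z * χ z = 0) : ∀ y ∈ U, P y = 0 := by
  intro y hy
  by_contra hne
  have hV : U ∩ {z | 0 < P y * P z} ∈ nhds y :=
    (hU.inter (isOpen_lt continuous_const (continuous_const.mul hP))).mem_nhds
      ⟨hy, mul_self_pos.2 hne⟩
  obtain ⟨r, hr, hrV⟩ := Metric.nhds_basis_closedBall.mem_iff.1 hV
  let χ : ContDiffBump y := ⟨r / 2, r, half_pos hr, half_lt_self hr⟩
  have hχs : tsupport χ ⊆ U ∩ {z | 0 < P y * P z} := by rw [χ.tsupport_eq]; exact hrV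
  have h1 := h χ χ.contDiff χ.hasCompactSupport (hχs.trans Set.inter_subset_left)
    fun z => χ.nonneg
  have h2 : 0 < ∫ z, P y * (P z * χ z) := by
    refine Continuous.integral_pos_of_hasCompactSupport_nonneg_nonzero (x := y)
      (continuous_const.mul (hP.mul χ.continuous)) χ.hasCompactSupport.mul_left.mul_left
      (fun z => ?_) ?_
    · by_cases hz : z ∈ tsupport χ
      · simpa [mul_assoc] using mul_nonneg (hχs hz).2.le (χ.nonneg (x := z))
      · simp [image_eq_zero_of_notMem_tsupport hz]
    · simp [hne, χ.one_of_mem_closedBall (Metric.mem_closedBall_self (half_pos hr).le)]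
  rw [integral_const_mul, h1, mul_zero] at h2
  exact h2.false

theorem continuousOn_of_subharmonicOn {N : ℕ} {Ω : Set (Cn N)} {u : Cn N → ℝ}
    (h1 : SubharmonicOn Ω fun z => (u z : EReal))
    (h2 : SubharmonicOn Ω fun z => ((-u z : ℝ) : EReal)) : ContinuousOn u Ω := by
  have h : ContinuousOn (fun z => (u z : EReal)) Ω := by
    refine continuousOn_iff_lower_upperSemicontinuousOn.2 ⟨fun x hx y hy => ?_, h1.usc⟩
    have := h2.usc x hx (-y) (by simpa using hy)
    simpa using this
  exact EReal.isEmbedding_coe.continuousOn_iff.2 h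

theorem setIntegral_closedBall_of_subharmonicOn {N : ℕ} {Ω : Set (Cn N)} {u : Cn N → ℝ}
    (h1 : SubharmonicOn Ω fun z => (u z : EReal))
    (h2 : SubharmonicOn Ω fun z => ((-u z : ℝ) : EReal)) {z : Cn N} {r : ℝ} (hr : 0 < r)
    (hs : Metric.closedBall z r ⊆ Ω) :
    ∫ w in Metric.closedBall z r, u w = volume.real (Metric.closedBall z r) * u z := by
  have hc := (continuousOn_of_subharmonicOn h1 h2).mono hs
  have e1 := (submean_iff hc).1 (h1.submean z r hr hs)
  have e2 := (submean_iff (u := fun w => -u w) hc.neg).1 (h2.submean z r hr hs)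
  rw [integral_neg] at e2
  linarith

/-- Since `n ≥ 2` there is at least one slot among the `n - 1` forms. It receives the rank-one form
and the others receive `β`, so the total power of `β` is `N - 2`. -/
theorem integral_mul_rankOne_nonneg {N n : ℕ} (hn : 1 < n) (hnN : n ≤ N) {Ω : Set (Cn N)}
    {u : Cn N → ℝ} (h : KSubharmonicOn n Ω fun z => (u z : EReal)) {χ : Cn N → ℝ}
    (hχ : ContDiff ℝ ∞ χ) (hc : HasCompactSupport χ) (hs : tsupport χ ⊆ Ω)
    (hpos : ∀ z, 0 ≤ χ z) (w : Cn N) :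
    0 ≤ ∫ z, u z *
      (‖w‖ ^ 2 * ∑ j, levi χ z (EuclideanSpace.single j 1) (EuclideanSpace.single j 1)
          - levi χ z w w) := by
  obtain ⟨p, rfl⟩ : ∃ p, n = p + 2 := ⟨n - 2, by omega⟩
  let α : Fin (p + 1) → CForm N := Fin.cons (form11 (rankOne w)) fun _ => kahler N
  have hα : ∀ i, α i ∈ Gam N (p + 2) := by
    refine Fin.cases ?_ fun i => ?_
    · exact form11_rankOne_mem_Gam _ w
    · exact kahler_mem_Gam N _ hnN
  have hprod : (List.ofFn α).prod = form11 (rankOne w) * kahler N ^ p := by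
    simp [α, List.ofFn_succ]
  have h1 := h.current_nonneg α hα χ hχ hc hs hpos
  have hN : p + (N - (p + 2)) = N - 2 := by omega
  have hq (z : Cn N) : ddc χ z * (List.ofFn α).prod * kahler N ^ (N - (p + 2)) =
      ddc χ z * form11 (rankOne w) * kahler N ^ (N - 2) := by
    rw [hprod, ← hN, pow_add]
    simp only [mul_assoc]
  have h2 : 0 ≤ ∫ z in Ω, (u z : EReal).toReal * (topCoeff N
      (ddc χ z * (List.ofFn α).prod * kahler N ^ (N - (p + 2)))).re := h1
  simp only [hq, EReal.toReal_coe, topCoeff_ddc_mul_rankOne hχ] at h2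
  rw [setIntegral_eq_integral_of_forall_compl_eq_zero] at h2
  · simp only [mul_left_comm (u _)] at h2
    rw [integral_const_mul] at h2
    refine nonneg_of_mul_nonneg_right h2 ?_
    have : (0 : ℝ) < N := by exact_mod_cast (by omega : 0 < N)
    have : (0 : ℝ) < (N - 1 : ℕ) := by exact_mod_cast (by omega : 0 < N - 1)
    positivity
  · intro z hz
    simp [levi_eq_zero_of_notMem_tsupport fun h => hz (hs h)]

/-- Applied to `u` and `-u`, each inequality becomes an equality. The mean value property yields
smoothness, and the rank-one pairings determine the whole Levi form. -/
theorem contDiffAt_and_levi_eq_zero {N n : ℕ} (hn : 1 < n) (hnN : n ≤ N) {Ω : Set (Cn N)}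
    (hΩ : IsOpen Ω) {u : Cn N → ℝ} (h1 : KSubharmonicOn n Ω fun z => (u z : EReal))
    (h2 : KSubharmonicOn n Ω fun z => ((-u z : ℝ) : EReal)) {x : Cn N} (hx : x ∈ Ω) :
    ContDiffAt ℝ ∞ u x ∧ ∀ w w', levi u x w w' = 0 := by
  obtain ⟨r, hr, hrΩ⟩ := Metric.nhds_basis_closedBall.mem_iff.1 (hΩ.mem_nhds hx)
  obtain ⟨R, rfl⟩ : ∃ R, r = 2 * R := ⟨r / 2, by ring⟩
  have hR : 0 < R := by linarith
  obtain ⟨g, hg, hug⟩ := exists_contDiff_eqOn_ball hR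
    ((continuousOn_of_subharmonicOn h1.subharmonic h2.subharmonic).mono hrΩ)
    fun z s hs hsub => setIntegral_closedBall_of_subharmonicOn h1.subharmonic h2.subharmonic hs
      (hsub.trans hrΩ)
  have hball : Metric.ball x R ⊆ Ω :=
    (Metric.ball_subset_closedBall.trans (Metric.closedBall_subset_closedBall (by linarith))).trans
      hrΩ
  have hev : u =ᶠ[nhds x] g := hug.eventuallyEq_of_mem (Metric.ball_mem_nhds x hR)
  refine ⟨hg.contDiffAt.congr_of_eventuallyEq hev, ?_⟩
  have hw (w : Cn N) : ‖w‖ ^ 2 * ∑ j, levi g x (EuclideanSpace.single j 1)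
      (EuclideanSpace.single j 1) - levi g x w w = 0 := by
    refine eq_zero_of_integral_mul_eq_zero (P := fun z => ‖w‖ ^ 2 * ∑ j, levi g z
      (EuclideanSpace.single j 1) (EuclideanSpace.single j 1) - levi g z w w) ?_
      (Metric.isOpen_ball (x := x) (ε := R)) (fun χ hχ hc hs hpos => ?_) x
      (Metric.mem_ball_self hR)
    · exact (continuous_const.mul (continuous_finsetSum _ fun j _ => continuous_levi hg _ _)).sub
        (continuous_levi hg _ _)
    · have e1 := integral_mul_rankOne_nonneg hn hnN h1 hχ hc (hs.trans hball) hpos w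
      have e2 := integral_mul_rankOne_nonneg hn hnN h2 hχ hc (hs.trans hball) hpos w
      simp only [neg_mul, integral_neg] at e2
      have e3 : ∫ z, u z * (‖w‖ ^ 2 * ∑ j, levi χ z (EuclideanSpace.single j 1)
          (EuclideanSpace.single j 1) - levi χ z w w) = 0 := by linarith
      have e4 : ∫ z, g z * (‖w‖ ^ 2 * ∑ j, levi χ z (EuclideanSpace.single j 1)
          (EuclideanSpace.single j 1) - levi χ z w w) = 0 := by
        rw [← e3]
        congr 1 with z
        by_cases hz : z ∈ tsupport χ
        · rw [hug (hs hz)]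
        · simp [levi_eq_zero_of_notMem_tsupport hz]
      have hi (v v' : Cn N) := integrable_mul_levi hg.continuous hχ hc v v'
      have hi' (v v' : Cn N) : Integrable fun z => levi g z v v' * χ z :=
        ((continuous_levi hg v v').mul hχ.continuous).integrable_of_hasCompactSupport hc.mul_left
      rw [← e4]
      simp only [mul_sub, sub_mul, Finset.mul_sum, Finset.sum_mul, mul_left_comm (g _), mul_assoc]
      rw [integral_sub (integrable_finsetSum _ fun j _ => (hi' _ _).const_mul _) (hi' _ _),
        integral_sub (integrable_finsetSum _ fun j _ => (hi _ _).const_mul _) (hi _ _),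
        integral_finsetSum _ fun j _ => (hi' _ _).const_mul _,
        integral_finsetSum _ fun j _ => (hi _ _).const_mul _, integral_mul_levi hg hχ hc]
      simp only [integral_const_mul, integral_mul_levi hg hχ hc]
  set T := ∑ j, levi g x (EuclideanSpace.single j 1) (EuclideanSpace.single j 1) with hT
  -- With `w = e_j` each diagonal entry equals the trace `T`, so `T = N * T`, and `N > 1` forces `T
  -- = 0`.
  have hTj (j : Fin N) : levi g x (EuclideanSpace.single j 1) (EuclideanSpace.single j 1) = T := by
    have := hw (EuclideanSpace.single j 1)
    simp at this
    linarith
  have hT0 : T = 0 := by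
    have h3 : T = N * T := by
      conv_lhs => rw [hT]
      simp [hTj]
    have h4 : ((N : ℝ) - 1) * T = 0 := by linarith
    have h5 : (1 : ℝ) < N := by exact_mod_cast hn.trans_le hnN
    exact (mul_eq_zero.1 h4).resolve_left (by linarith)
  intro w w'
  rw [levi_congr hev]
  refine levi_eq_zero_of_diag (contDiffAt_two hg x) (fun w => ?_) w w'
  have := hw w
  rw [hT0] at this
  linarith

/-! ### Calculus of complex valued functions -/

section Calculus

variable {E : Type*} [NormedAddCommGroup E] [NormedSpace ℂ E]

theorem differentiableAt_complex_of_map_I_smul {f : E → ℂ} {z : E} {L : E →L[ℝ] ℂ}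
    (hf : HasFDerivAt f L z) (h : ∀ w, L (Complex.I • w) = Complex.I * L w) :
    DifferentiableAt ℂ f z := by
  let L' : E →L[ℂ] ℂ :=
    { toFun := L
      map_add' := L.map_add
      map_smul' := fun c w => by
        have hc : c • w = c.re • w + c.im • Complex.I • w := by
          conv_lhs => rw [← Complex.re_add_im c]
          rw [add_smul, mul_smul, Complex.coe_smul, Complex.coe_smul]
        rw [hc, map_add, map_smul, map_smul, h, RingHom.id_apply, smul_eq_mul]
        conv_rhs => rw [← Complex.re_add_im c]
        simp only [Complex.real_smul]
        ring
      cont := L.cont }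
  exact (hasFDerivAt_of_restrictScalars ℝ hf (f' := L') rfl).differentiableAt

/-- A holomorphic function on a connected open set that vanishes near a point is zero. -/
theorem eqOn_zero_of_eventuallyEq_zero {f : E → ℂ} {Ω : Set E} (hf : DifferentiableOn ℂ f Ω)
    (hΩ : IsOpen Ω) (hc : IsPreconnected Ω) {z₀ : E} (hz₀ : z₀ ∈ Ω)
    (h0 : ∀ᶠ z in nhds z₀, f z = 0) : ∀ z ∈ Ω, f z = 0 := by
  -- The set of points near which `f` vanishes is open; it remains to see that it is closed relative
  -- to `Ω`.
  let U : Set E := {z | ∀ᶠ y in nhds z, f y = 0}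
  have hU : IsOpen U := isOpen_setOfPred_eventually_nhds
  have hsub : Ω ⊆ U := by
    refine hc.subset_of_closure_inter_subset hU ⟨z₀, hz₀, h0⟩ ?_
    rintro z ⟨hzU, hz⟩
    obtain ⟨r, hr, hrΩ⟩ := Metric.isOpen_iff.1 hΩ z hz
    obtain ⟨p, hpU, hp⟩ := Metric.mem_closure_iff.1 hzU r hr
    have hpb : p ∈ Metric.ball z r := by rwa [Metric.mem_ball, dist_comm]
    refine Filter.eventually_of_mem (Metric.ball_mem_nhds z hr) fun q hq => ?_
    -- On the complex line from `p`, near which `f` vanishes, to an arbitrary `q` in the ball, the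
    -- one-variable identity theorem applies; the parameter set is convex and hence connected.
    let ℓ : ℂ → E := fun t => p + t • (q - p)
    have hℓ : Differentiable ℂ ℓ := by fun_prop
    have hV : IsOpen (ℓ ⁻¹' Metric.ball z r) := Metric.isOpen_ball.preimage hℓ.continuous
    have hVc : Convex ℝ (ℓ ⁻¹' Metric.ball z r) := by
      intro s hs t ht a b ha hb hab
      have : ℓ (a • s + b • t) = a • ℓ s + b • ℓ t := by
        have hab' : a • p + b • p = p := by rw [← add_smul, hab, one_smul]
        simp only [ℓ, smul_add, add_smul, smul_assoc]
        rw [add_add_add_comm, hab']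
      rw [Set.mem_preimage, this]
      exact convex_ball z r hs ht ha hb hab
    have hdiff : DifferentiableOn ℂ (f ∘ ℓ) (ℓ ⁻¹' Metric.ball z r) :=
      (hf.mono hrΩ).comp hℓ.differentiableOn fun t ht => ht
    have hp0 : ℓ 0 = p := by simp [ℓ]
    have hq1 : ℓ 1 = q := by simp [ℓ]
    have hev : f ∘ ℓ =ᶠ[nhds 0] 0 := by
      have : Filter.Tendsto ℓ (nhds 0) (nhds p) := by
        have := hℓ.continuous.tendsto 0
        rwa [hp0] at this
      exact this.eventually hpU
    have := (hdiff.analyticOnNhd hV).eqOn_zero_of_preconnected_of_eventuallyEq_zero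
      hVc.isPreconnected (z₀ := 0) (by simpa [hp0] using hpb) hev (x := 1)
      (by simpa [hq1] using hq)
    simpa [hq1] using this
  exact fun z hz => (hsub hz).self_of_nhds

theorem eventually_differentiableAt {f : E → ℂ} {z : E} (hf : ContDiffAt ℝ 2 f z) :
    ∀ᶠ y in nhds z, DifferentiableAt ℝ f y :=
  (hf.eventually (by simp)).mono fun _ hy => hy.differentiableAt (by simp)

theorem differentiableAt_fderiv_apply {f : E → ℂ} {z : E} (hf : ContDiffAt ℝ 2 f z) (w : E) :
    DifferentiableAt ℝ (fun y => fderiv ℝ f y w) z :=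
  ((hf.fderiv_right (m := 1) (by norm_num)).differentiableAt (by norm_num)).clm_apply
    (differentiableAt_const _)

theorem levi_clm_comp {f : E → ℂ} {z : E} (hf : ContDiffAt ℝ 2 f z) (L : ℂ →L[ℝ] ℝ) (w w' : E) :
    levi (fun y => L (f y)) z w w' = L (levi f z w w') := by
  have hL {s : E → ℂ} {y : E} (hs : DifferentiableAt ℝ s y) (v : E) :
      fderiv ℝ (fun y => L (s y)) y v = L (fderiv ℝ s y v) := by
    have := (L.hasFDerivAt.comp y hs.hasFDerivAt).fderiv
    exact congrArg (fun A : E →L[ℝ] ℝ => A v) this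
  have h (v v' : E) : hess (fun y => L (f y)) z v v' = L (hess f z v v') := by
    have h0 : ContDiffAt ℝ 2 (fun y => L (f y)) z := L.contDiff.contDiffAt.comp z hf
    rw [← fderiv_fderiv_apply h0, ← fderiv_fderiv_apply hf]
    have h1 : (fun y => fderiv ℝ (fun y => L (f y)) y v') =ᶠ[nhds z]
        fun y => L (fderiv ℝ f y v') := by
      filter_upwards [eventually_differentiableAt hf] with y hy
      exact hL hy v'
    rw [h1.fderiv_eq, hL (differentiableAt_fderiv_apply hf v')]
  rw [levi, h, h, ← map_add, levi]

theorem hess_mul {f g : E → ℂ} {z : E} (hf : ContDiffAt ℝ 2 f z) (hg : ContDiffAt ℝ 2 g z)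
    (w w' : E) :
    hess (fun y => f y * g y) z w w' = hess f z w w' * g z + f z * hess g z w w' +
      (fderiv ℝ f z w * fderiv ℝ g z w' + fderiv ℝ f z w' * fderiv ℝ g z w) := by
  rw [← fderiv_fderiv_apply (hf.mul hg), ← fderiv_fderiv_apply hf, ← fderiv_fderiv_apply hg]
  have h1 : (fun y => fderiv ℝ (fun y => f y * g y) y w') =ᶠ[nhds z]
      fun y => f y * fderiv ℝ g y w' + g y * fderiv ℝ f y w' := by
    filter_upwards [eventually_differentiableAt hf, eventually_differentiableAt hg] with y hy hy'
    rw [fderiv_fun_mul hy hy']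
    rfl
  have hf1 := (hf.differentiableAt (by simp)).hasFDerivAt
  have hg1 := (hg.differentiableAt (by simp)).hasFDerivAt
  have hf2 := (differentiableAt_fderiv_apply hf w').hasFDerivAt
  have hg2 := (differentiableAt_fderiv_apply hg w').hasFDerivAt
  rw [h1.fderiv_eq, ((hf1.fun_mul hg2).fun_add (hg1.fun_mul hf2)).fderiv]
  simp
  ring

theorem levi_mul {f g : E → ℂ} {z : E} (hf : ContDiffAt ℝ 2 f z) (hg : ContDiffAt ℝ 2 g z)
    (w w' : E) :
    levi (fun y => f y * g y) z w w' = levi f z w w' * g z + f z * levi g z w w' +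
      (fderiv ℝ f z w * fderiv ℝ g z w' + fderiv ℝ f z w' * fderiv ℝ g z w
        + fderiv ℝ f z (Complex.I • w) * fderiv ℝ g z (Complex.I • w')
        + fderiv ℝ f z (Complex.I • w') * fderiv ℝ g z (Complex.I • w)) := by
  simp only [levi, hess_mul hf hg]
  ring

/-! ### The linear and antilinear parts of the derivative. -/

/-- Twice the `ℂ`-linear part of the derivative of `f`. -/
def del (f : E → ℂ) (z w : E) : ℂ :=
  fderiv ℝ f z w - Complex.I * fderiv ℝ f z (Complex.I • w)

/-- Twice the antilinear part of the derivative of `f`. -/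
def delbar (f : E → ℂ) (z w : E) : ℂ :=
  fderiv ℝ f z w + Complex.I * fderiv ℝ f z (Complex.I • w)

/-- The Leibniz rule for `∂∂̄(fg)` leaves only the cross terms. Combining the real bilinear identity
at `(w, w')` with `i` times the one at `(w, i w')` separates `∂` from `∂̄`. -/
theorem del_mul_delbar_add {f g : E → ℂ} {z : E} (hf : ContDiffAt ℝ 2 f z)
    (hg : ContDiffAt ℝ 2 g z) (hlf : ∀ w w', levi f z w w' = 0) (hlg : ∀ w w', levi g z w w' = 0)
    (hl : ∀ w w', levi (fun y => f y * g y) z w w' = 0) (w w' : E) :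
    del f z w * delbar g z w' + delbar f z w' * del g z w = 0 := by
  have h1 := hl w w'
  have h2 := hl w (Complex.I • w')
  rw [levi_mul hf hg, hlf, hlg] at h1 h2
  simp only [smul_smul, Complex.I_mul_I, neg_smul, one_smul, map_neg] at h2
  simp only [del, delbar]
  linear_combination h1 + Complex.I * h2 -
    (fderiv ℝ f z (Complex.I • w) * fderiv ℝ g z (Complex.I • w')
      + fderiv ℝ f z (Complex.I • w') * fderiv ℝ g z (Complex.I • w)) * Complex.I_mul_I

theorem differentiableAt_of_delbar_eq_zero {f : E → ℂ} {z : E} (hf : DifferentiableAt ℝ f z)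
    (h : ∀ w, delbar f z w = 0) : DifferentiableAt ℂ f z := by
  refine differentiableAt_complex_of_map_I_smul hf.hasFDerivAt fun w => ?_
  have := h w
  rw [delbar] at this
  linear_combination -Complex.I * this + fderiv ℝ f z (Complex.I • w) * Complex.I_mul_I

theorem differentiableAt_conj_of_del_eq_zero {f : E → ℂ} {z : E} (hf : DifferentiableAt ℝ f z)
    (h : ∀ w, del f z w = 0) : DifferentiableAt ℂ (fun y => starRingEnd ℂ (f y)) z := by
  refine differentiableAt_complex_of_map_I_smul
    (Complex.conjCLE.toContinuousLinearMap.hasFDerivAt.comp z hf.hasFDerivAt) fun w => ?_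
  have h1 := h w
  rw [del] at h1
  have h2 : fderiv ℝ f z (Complex.I • w) = -Complex.I * fderiv ℝ f z w := by
    linear_combination Complex.I * h1 + fderiv ℝ f z (Complex.I • w) * Complex.I_mul_I
  simp [h2]

/-- The antilinear part of the derivative of `∂f(w)` is a value of `∂̄∂f`, which vanishes for
pluriharmonic `f`. This makes the identity theorem available for `∂f`. -/
theorem differentiableAt_del {f : E → ℂ} {z : E} (hf : ContDiffAt ℝ 2 f z)
    (hl : ∀ w w', levi f z w w' = 0) (w : E) : DifferentiableAt ℂ (fun y => del f y w) z := by
  have h1 := (differentiableAt_fderiv_apply hf w).hasFDerivAt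
  have h2 := (differentiableAt_fderiv_apply hf (Complex.I • w)).hasFDerivAt
  refine differentiableAt_complex_of_map_I_smul (h1.fun_sub (h2.const_mul Complex.I)) fun v => ?_
  have h3 := hl v w
  have h4 := hl v (Complex.I • w)
  simp only [levi, smul_smul, Complex.I_mul_I, neg_smul, one_smul, map_neg] at h3 h4
  simp [fderiv_fderiv_apply hf]
  linear_combination -h4 - Complex.I * h3 + hess f z v (Complex.I • w) * Complex.I_mul_I

end Calculus

/-! ### Pluriharmonic test functions and the conclusion -/

theorem hasFDerivAt_coord {M : ℕ} (j : Fin M) (z : Cn M) :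
    HasFDerivAt (fun y : Cn M => y j)
      ((EuclideanSpace.proj j : Cn M →L[ℂ] ℂ).restrictScalars ℝ) z :=
  ((EuclideanSpace.proj j : Cn M →L[ℂ] ℂ).restrictScalars ℝ).hasFDerivAt

theorem contDiff_coord {M : ℕ} (j : Fin M) : ContDiff ℝ ∞ fun y : Cn M => y j :=
  ((EuclideanSpace.proj j : Cn M →L[ℂ] ℂ).restrictScalars ℝ).contDiff

theorem levi_coord {M : ℕ} (j : Fin M) (z w w' : Cn M) : levi (fun y : Cn M => y j) z w w' = 0 := by
  have h : fderiv ℝ (fun y : Cn M => y j) =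
      fun _ => (EuclideanSpace.proj j : Cn M →L[ℂ] ℂ).restrictScalars ℝ :=
    funext fun y => (hasFDerivAt_coord j y).fderiv
  simp [levi, hess, h]

theorem levi_coord_mul {M : ℕ} (j k : Fin M) (z w w' : Cn M) :
    levi (fun y : Cn M => y j * y k) z w w' = 0 := by
  rw [levi_mul (contDiffAt_two (contDiff_coord j) z) (contDiffAt_two (contDiff_coord k) z),
    levi_coord, levi_coord, (hasFDerivAt_coord j z).fderiv, (hasFDerivAt_coord k z).fderiv]
  simp
  linear_combination (w j * w' k + w' j * w k) * Complex.I_mul_I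

theorem IsSubharmonicMorphism.comp_contDiffAt {M N m n : ℕ} (hn : 1 < n) (hnN : n ≤ N)
    {Ω : Set (Cn N)} (hΩ : IsOpen Ω) {Ω' : Set (Cn M)} {F : Cn N → Cn M}
    (hF : IsSubharmonicMorphism m n Ω Ω' F) {h : Cn M → ℂ} (hh : ContDiff ℝ ∞ h)
    (hl : ∀ z w w', levi h z w w' = 0)
    (h4 : ∀ z w,
      h (z + w) + h (z + Complex.I • w) + h (z - w) + h (z - Complex.I • w) = 4 * h z)
    {x : Cn N} (hx : x ∈ Ω) :
    ContDiffAt ℝ ∞ (fun z => h (F z)) x ∧ ∀ w w', levi (fun z => h (F z)) x w w' = 0 := by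
  have key (L : ℂ →L[ℝ] ℝ) : KSubharmonicOn n Ω fun z => ((L (h (F z)) : ℝ) : EReal) := by
    refine hF.comp (fun z => ((L (h z) : ℝ) : EReal))
      (kSubharmonicOn_of_levi_eq_zero m Ω' (L.contDiff.comp hh) (fun z w w' => ?_) fun z w => ?_)
    · change levi (fun y => L (h y)) z w w' = 0
      rw [levi_clm_comp (contDiffAt_two hh z), hl, map_zero]
    · have h5 : (4 : ℂ) * h z = (4 : ℝ) • h z := by simp
      have := congrArg L (h4 z w)
      rw [h5, map_smul] at this
      simpa using this
  -- Using `-L` along with `L` supplies the two-sided subharmonicity.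
  have key2 (L : ℂ →L[ℝ] ℝ) := contDiffAt_and_levi_eq_zero hn hnN hΩ (key L) (key (-L)) hx
  have hr := key2 Complex.reCLM
  have hi := key2 Complex.imCLM
  have hc : ContDiffAt ℝ ∞ (fun z => h (F z)) x := by
    have h1 := (Complex.ofRealCLM.contDiff.contDiffAt.comp x hr.1).add
      ((Complex.ofRealCLM.contDiff.contDiffAt.comp x hi.1).mul (contDiffAt_const (c := Complex.I)))
    refine h1.congr_of_eventuallyEq (Filter.Eventually.of_forall fun z => ?_)
    simp [Complex.re_add_im]
  have hc2 : ContDiffAt ℝ 2 (fun z => h (F z)) x := by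
    exact_mod_cast contDiffAt_infty.1 hc 2
  refine ⟨hc, fun w w' => Complex.ext ?_ ?_⟩
  · exact (levi_clm_comp hc2 Complex.reCLM w w').symm.trans (hr.2 w w')
  · exact (levi_clm_comp hc2 Complex.imCLM w w').symm.trans (hi.2 w w')

end CNS

end

/-! ### The dichotomy between holomorphic and antiholomorphic maps. -/

theorem mainTheorem3 (M N m n : ℕ) (hm : 1 ≤ m) (hmM : m ≤ M) (hn : 1 < n) (hnN : n ≤ N)
    (Ω : Set (CNS.Cn N)) (hΩ : IsOpen Ω) (hΩc : IsConnected Ω)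
    (Ω' : Set (CNS.Cn M)) (hΩ' : IsOpen Ω') (hΩ'c : IsConnected Ω')
    (F : CNS.Cn N → CNS.Cn M) (hF : CNS.IsSubharmonicMorphism m n Ω Ω' F) :
    DifferentiableOn ℂ F Ω ∨ DifferentiableOn ℂ (CNS.conjMap F) Ω := by
  -- The four point identity holds for coordinates because `w + iw - w - iw = 0`, and for their
  -- products because in addition `1 + i² + 1 + i² = 0`.
  have h1 (j : Fin M) {x : CNS.Cn N} (hx : x ∈ Ω) := hF.comp_contDiffAt hn hnN hΩ
    (CNS.contDiff_coord j) (CNS.levi_coord j) (fun z w => by simp; ring) hx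
  have h2 (j k : Fin M) {x : CNS.Cn N} (hx : x ∈ Ω) := (hF.comp_contDiffAt hn hnN hΩ
    ((CNS.contDiff_coord j).mul (CNS.contDiff_coord k)) (CNS.levi_coord_mul j k)
    (fun z w => by simp; linear_combination 2 * w j * w k * Complex.I_mul_I) hx).2
  have hc (j : Fin M) {x : CNS.Cn N} (hx : x ∈ Ω) : ContDiffAt ℝ 2 (fun z => F z j) x := by
    exact_mod_cast contDiffAt_infty.1 (h1 j hx).1 2
  have h3 (j k : Fin M) {x : CNS.Cn N} (hx : x ∈ Ω) := CNS.del_mul_delbar_add (hc j hx) (hc k hx)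
    (h1 j hx).2 (h1 k hx).2 (h2 j k hx)
  by_cases hol : ∀ k, ∀ x ∈ Ω, ∀ w, CNS.delbar (fun z => F z k) x w = 0
  · refine .inl (differentiableOn_euclidean.2 fun k x hx => ?_)
    exact (CNS.differentiableAt_of_delbar_eq_zero ((hc k hx).differentiableAt (by simp))
      (hol k x hx)).differentiableWithinAt
  · push Not at hol
    obtain ⟨k, x₀, hx₀, w₀, hne⟩ := hol
    have hcont : ContinuousAt (fun y => CNS.delbar (fun z => F z k) y w₀) x₀ :=
      ((CNS.differentiableAt_fderiv_apply (hc k hx₀) w₀).add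
        ((CNS.differentiableAt_fderiv_apply (hc k hx₀) (Complex.I • w₀)).const_mul
          Complex.I)).continuousAt
    have hev : ∀ᶠ y in nhds x₀, y ∈ Ω ∧ CNS.delbar (fun z => F z k) y w₀ ≠ 0 :=
      Filter.Eventually.and (hΩ.mem_nhds hx₀) (hcont.eventually_ne hne)
    refine .inr (differentiableOn_euclidean.2 fun j x hx => ?_)
    refine (CNS.differentiableAt_conj_of_del_eq_zero ((hc j hx).differentiableAt (by simp))
      fun w => ?_).differentiableWithinAt
    refine CNS.eqOn_zero_of_eventuallyEq_zero
      (f := fun y => CNS.del (fun z => F z j) y w) (fun y hy =>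
        (CNS.differentiableAt_del (hc j hy) (h1 j hy).2 w).differentiableWithinAt)
      hΩ hΩc.isPreconnected hx₀ (hev.mono fun y ⟨hy, hyne⟩ => ?_) x hx
    -- The relation with `j = k` reads `2 ∂F^k(w) ∂̄F^k(w₀) = 0`, and its second factor is nonzero
    -- at `y`.
    have h4 : CNS.del (fun z => F z k) y w = 0 := by
      have := h3 k k hy w w₀
      rw [mul_comm (CNS.delbar _ _ _), ← two_mul] at this
      simpa [hyne] using this
    -- With `∂F^k = 0` at `y`, the mixed relation reduces to `∂F^j(w) ∂̄F^k(w₀) = 0`.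
    have h5 := h3 j k hy w w₀
    rw [h4, mul_zero, add_zero] at h5
    exact (mul_eq_zero.1 h5).resolve_right hyne
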